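/- Let $(\mathcal M,g)$ be a 4-dimensional generalized Robertson–Walker (GRW) spacetime, that is, $\mathcal M=I\times M^*$ with $g=-dt^2+a(t)^2g^*$, where $I\subseteq\mathbb R$ is a nonempty open interval, $a>0$ is a smooth function on $I$ and $(M^*,g^*)$ is a 3-dimensional Riemannian manifold. Let $\rho$ be a smooth unit timelike torse-forming vector field on $\mathcal M$ which is an eigenvector of the Ricci tensor $S$, i.e. $g(\rho,\rho)=-1$, $\nabla_U\rho=\psi\,(U+\eta(U)\rho)$ with $\eta=g(\cdot,\rho)$ and $\psi$ a smooth function, and $S(U,\rho)=\xi\,\eta(U)$ for a function $\xi$ (for instance $\rho=\partial_t$, $\psi=a'/a$). Put $\mu=\rho\psi+\psi^2$. Suppose that $g$ is a gradient $(m,\tau)$-quasi Einstein soliton: for real constants $m,\tau,\lambda_1$ with $0<m<\infty$ and a smooth function $f$ on $\mathcal M$, $$\nabla^2 f+S-\frac1m\,df\otimes df=(\lambda_1+\tau r)\,g=\beta_1\,g,$$ where $r$ is the scalar curvature. If $\beta_1=(n-1)\mu=3\mu$ is a nonzero constant and $\rho f$ is constant, then $(\mathcal M,g)$ is a Robertson–Walker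 spacetime, i.e. $(M^*,g^*)$ has constant sectional curvature. -/

import Mathlib

open scoped Manifold ContDiff

noncomputable section

/-! ### Semi-Riemannian geometry in coordinates

`E` is the coordinate space, with coordinate basis `b`; a (semi-Riemannian) metric is given by its
matrix of components `g : E → Matrix ι ι ℝ`. -/

namespace Coord

variable {ι : Type*} [Fintype ι] [DecidableEq ι]
  {E : Type*} [NormedAddCommGroup E] [NormedSpace ℝ E]

/-- The partial derivative `∂ᵢ h`. -/
def pd (b : Module.Basis ι ℝ E) (i : ι) (h : E → ℝ) (x : E) : ℝ :=
  fderiv ℝ h x (b i)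

/-- The Christoffel symbol `Γᵏᵢⱼ = ½ ∑ₗ gᵏˡ (∂ᵢ gⱼₗ + ∂ⱼ gᵢₗ - ∂ₗ gᵢⱼ)` of the Levi-Civita connection. -/
def christoffel (b : Module.Basis ι ℝ E) (g : E → Matrix ι ι ℝ) (k i j : ι) (x : E) : ℝ :=
  1 / 2 * ∑ l, (g x)⁻¹ k l *
    (pd b i (fun y => g y j l) x + pd b j (fun y => g y i l) x - pd b l (fun y => g y i j) x)

/-- The components `Rˡᵢⱼₖ` of the curvature tensor
`R(U,V)W = ∇_U ∇_V W - ∇_V ∇_U W - ∇_[U,V] W`, that is `R(∂ᵢ,∂ⱼ)∂ₖ = ∑ₗ Rˡᵢⱼₖ ∂ₗ`. -/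
def riemann (b : Module.Basis ι ℝ E) (g : E → Matrix ι ι ℝ) (l i j k : ι) (x : E) : ℝ :=
  pd b i (christoffel b g l j k) x - pd b j (christoffel b g l i k) x
    + ∑ s, (christoffel b g l i s x * christoffel b g s j k x
      - christoffel b g l j s x * christoffel b g s i k x)

/-- The components `Sⱼₖ` of the Ricci tensor `S(V,W) = tr (U ↦ R(U,V)W)`. -/
def ricci (b : Module.Basis ι ℝ E) (g : E → Matrix ι ι ℝ) (j k : ι) (x : E) : ℝ :=
  ∑ i, riemann b g i i j k x

/-- The scalar curvature `r = ∑ gʲᵏ Sⱼₖ`. -/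
def scalar (b : Module.Basis ι ℝ E) (g : E → Matrix ι ι ℝ) (x : E) : ℝ :=
  ∑ j, ∑ k, (g x)⁻¹ j k * ricci b g j k x

/-- The components `∇ᵢ∇ⱼ f = ∂ᵢ∂ⱼ f - ∑ₖ Γᵏᵢⱼ ∂ₖ f` of the Hessian of a function. -/
def hess (b : Module.Basis ι ℝ E) (g : E → Matrix ι ι ℝ) (f : E → ℝ) (i j : ι) (x : E) : ℝ :=
  pd b i (pd b j f) x - ∑ k, christoffel b g k i j x * pd b k f x

/-- The components `∇ᵢ ρᵏ = ∂ᵢ ρᵏ + ∑ⱼ Γᵏᵢⱼ ρʲ` of the covariant derivative of a vector field. -/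
def covDeriv (b : Module.Basis ι ℝ E) (g : E → Matrix ι ι ℝ) (ρ : ι → E → ℝ) (i k : ι) (x : E) :
    ℝ :=
  pd b i (ρ k) x + ∑ j, christoffel b g k i j x * ρ j x

/-- The pairing `g(u,v) = ∑ gᵢⱼ uⁱ vʲ` at `x`. -/
def pair (g : E → Matrix ι ι ℝ) (x : E) (u v : ι → ℝ) : ℝ :=
  ∑ i, ∑ j, g x i j * u i * v j

/-- The sectional curvature
`g(R(u,v)v,u) / (g(u,u) g(v,v) - g(u,v)²)` of the plane spanned by `u` and `v` at `x`. -/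
def sectional (b : Module.Basis ι ℝ E) (g : E → Matrix ι ι ℝ) (x : E) (u v : ι → ℝ) : ℝ :=
  pair g x (fun l => ∑ i, ∑ j, ∑ k, riemann b g l i j k x * u i * v j * v k) u
    / (pair g x u u * pair g x v v - pair g x u v ^ 2)

end Coord

/-! ### Components of tensor fields in a chart of a manifold (without boundary) -/

namespace InChart

variable {ι : Type*} {E : Type*} [NormedAddCommGroup E] [NormedSpace ℝ E]
  {H : Type*} [TopologicalSpace H] (I : ModelWithCorners ℝ E H) [I.Boundaryless]
  {M : Type*} [TopologicalSpace M] [ChartedSpace H M]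

/-- The coordinate vector field `∂ᵢ` of the chart `e`, at the point with coordinates `x`. -/
def coordVec (b : Module.Basis ι ℝ E) (e : OpenPartialHomeomorph M H) (i : ι) (x : E) :
    TangentSpace I ((e.extend I).symm x) :=
  mfderiv 𝓘(ℝ, E) I (e.extend I).symm x (b i)

/-- The matrix `gᵢⱼ = g(∂ᵢ,∂ⱼ)` in the chart `e`, as a function of the coordinates. -/
def metric (b : Module.Basis ι ℝ E) (e : OpenPartialHomeomorph M H)
    (g : ∀ p : M, TangentSpace I p → TangentSpace I p → ℝ) (x : E) : Matrix ι ι ℝ :=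
  Matrix.of fun i j => g ((e.extend I).symm x) (coordVec I b e i x) (coordVec I b e j x)

/-- A function on the manifold in the chart `e`. -/
def func (e : OpenPartialHomeomorph M H) (f : M → ℝ) (x : E) : ℝ :=
  f ((e.extend I).symm x)

/-- The components `ρᵏ = dxᵏ(ρ)` of a vector field in the chart `e`. -/
def vec (b : Module.Basis ι ℝ E) (e : OpenPartialHomeomorph M H)
    (ρ : ∀ p : M, TangentSpace I p) (k : ι) (x : E) : ℝ :=
  b.repr (mfderiv I 𝓘(ℝ, E) (e.extend I) ((e.extend I).symm x)
    (ρ ((e.extend I).symm x)) : E) k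

/-- The derivative `U f` of a function along a vector field. -/
def along (ρ : ∀ p : M, TangentSpace I p) (f : M → ℝ) (p : M) : ℝ :=
  mfderiv I 𝓘(ℝ, ℝ) f p (ρ p)

end InChart

/-- The standard basis of `ℝᵈ`. -/
abbrev stdBasis (d : ℕ) : Module.Basis (Fin d) ℝ (EuclideanSpace ℝ (Fin d)) :=
  (EuclideanSpace.basisFun (Fin d) ℝ).toBasis

/-- The standard basis of `ℝ × ℝᵈ`; the index `Sum.inl ()` is the time coordinate. -/
abbrev spacetimeBasis (d : ℕ) :
    Module.Basis (Unit ⊕ Fin d) ℝ (ℝ × EuclideanSpace ℝ (Fin d)) :=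
  (Module.Basis.singleton Unit ℝ).prod (stdBasis d)

/-- The Riemannian metric `h` on the `d`-dimensional manifold `N` has constant sectional curvature:
all tangent planes at all points have the same sectional curvature. -/
def HasConstantSectionalCurvature {d : ℕ} {N : Type*} [TopologicalSpace N]
    [ChartedSpace (EuclideanSpace ℝ (Fin d)) N] [IsManifold (𝓡 d) ∞ N]
    (h : Bundle.ContMDiffRiemannianMetric (𝓡 d) ∞ (EuclideanSpace ℝ (Fin d))
      (fun p : N => TangentSpace (𝓡 d) p)) : Prop :=
  ∃ κ : ℝ, ∀ e ∈ atlas (EuclideanSpace ℝ (Fin d)) N, ∀ p ∈ e.source,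
    ∀ u v : Fin d → ℝ, LinearIndependent ℝ ![u, v] →
      Coord.sectional (stdBasis d)
        (InChart.metric (𝓡 d) (stdBasis d) e fun p v w => h.inner p v w)
        (e.extend (𝓡 d) p) u v = κ

/-- The model with corners of `ℝ × N`, where `N` has dimension `d`. -/
abbrev spacetimeModel (d : ℕ) :
    ModelWithCorners ℝ (ℝ × EuclideanSpace ℝ (Fin d)) (ModelProd ℝ (EuclideanSpace ℝ (Fin d))) :=
  𝓘(ℝ, ℝ).prod (𝓡 d)

/-- A generalized Robertson-Walker spacetime `-I ×_{a²} N` of dimension `d + 1`: a nonempty open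
interval `I`, a smooth positive function `a` on it, and a Riemannian metric on the
`d`-dimensional fibre `N`. -/
structure GRWSpacetime (d : ℕ) (N : Type*) [TopologicalSpace N]
    [ChartedSpace (EuclideanSpace ℝ (Fin d)) N] [IsManifold (𝓡 d) ∞ N] where
  interval : Set ℝ
  isOpen_interval : IsOpen interval
  ordConnected_interval : interval.OrdConnected
  nonempty_interval : interval.Nonempty
  scale : ℝ → ℝ
  contDiffOn_scale : ContDiffOn ℝ ∞ scale interval
  scale_pos : ∀ t ∈ interval, 0 < scale t
  fibreMetric : Bundle.ContMDiffRiemannianMetric (𝓡 d) ∞ (EuclideanSpace ℝ (Fin d))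
    (fun p : N => TangentSpace (𝓡 d) p)

namespace GRWSpacetime

variable {d : ℕ} {N : Type*} [TopologicalSpace N]
    [ChartedSpace (EuclideanSpace ℝ (Fin d)) N] [IsManifold (𝓡 d) ∞ N]

/-- The underlying manifold `I × N`, as an open subset of `ℝ × N`. -/
def carrier (S : GRWSpacetime d N) : Set (ℝ × N) :=
  {q | q.1 ∈ S.interval}

/-- The Lorentzian metric `-dt² + a(t)² h`. A tangent vector of `ℝ × N` is a pair of tangent
vectors of `ℝ` and of `N`. -/
def lorentz (S : GRWSpacetime d N) (q : ℝ × N)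
    (v w : TangentSpace (spacetimeModel d) q) : ℝ :=
  -((v : ℝ × EuclideanSpace ℝ (Fin d)).1 * (w : ℝ × EuclideanSpace ℝ (Fin d)).1)
    + S.scale q.1 ^ 2 * S.fibreMetric.inner q.2
      (v : ℝ × EuclideanSpace ℝ (Fin d)).2 (w : ℝ × EuclideanSpace ℝ (Fin d)).2

/-- The matrix of the Lorentzian metric in the chart `e` of `ℝ × N`. -/
def metric (S : GRWSpacetime d N)
    (e : OpenPartialHomeomorph (ℝ × N) (ModelProd ℝ (EuclideanSpace ℝ (Fin d)))) :
    ℝ × EuclideanSpace ℝ (Fin d) → Matrix (Unit ⊕ Fin d) (Unit ⊕ Fin d) ℝ :=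
  InChart.metric (spacetimeModel d) (spacetimeBasis d) e S.lorentz

/-- A property of a chart `e` and coordinates `x` in it holds for all charts of the (product) atlas,
at all points of the spacetime. -/
def Everywhere (S : GRWSpacetime d N)
    (P : OpenPartialHomeomorph (ℝ × N) (ModelProd ℝ (EuclideanSpace ℝ (Fin d))) →
      ℝ × EuclideanSpace ℝ (Fin d) → Prop) : Prop :=
  ∀ e ∈ atlas (ModelProd ℝ (EuclideanSpace ℝ (Fin d))) (ℝ × N), ∀ q ∈ e.source, q ∈ S.carrier →
    P e (e.extend (spacetimeModel d) q)

/-- `ρ` is a smooth unit timelike torse-forming vector field, `∇_U ρ = ψ (U + η(U) ρ)` with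
`η = g(·, ρ)`, and it is an eigenvector of the Ricci tensor, `S(U, ρ) = ξ η(U)`. -/
structure IsTorseForming (S : GRWSpacetime d N)
    (ρ : ∀ q : ℝ × N, TangentSpace (spacetimeModel d) q) (ψ : ℝ × N → ℝ) : Prop where
  smooth : ContMDiffOn (spacetimeModel d) (spacetimeModel d).tangent ∞
    (fun q => (⟨q, ρ q⟩ : TangentBundle (spacetimeModel d) (ℝ × N))) S.carrier
  smooth_coeff : ContMDiffOn (spacetimeModel d) 𝓘(ℝ, ℝ) ∞ ψ S.carrier
  unit : ∀ q ∈ S.carrier, S.lorentz q (ρ q) (ρ q) = -1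
  torse : S.Everywhere fun e x => ∀ i k,
    Coord.covDeriv (spacetimeBasis d) (S.metric e)
        (InChart.vec (spacetimeModel d) (spacetimeBasis d) e ρ) i k x
      = InChart.func (spacetimeModel d) e ψ x *
        ((if i = k then 1 else 0)
          + (∑ j, S.metric e x i j * InChart.vec (spacetimeModel d) (spacetimeBasis d) e ρ j x)
            * InChart.vec (spacetimeModel d) (spacetimeBasis d) e ρ k x)
  eigen : ∃ ξ : ℝ × N → ℝ, S.Everywhere fun e x => ∀ i,
    ∑ j, Coord.ricci (spacetimeBasis d) (S.metric e) i j x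
          * InChart.vec (spacetimeModel d) (spacetimeBasis d) e ρ j x
      = InChart.func (spacetimeModel d) e ξ x *
        ∑ j, S.metric e x i j * InChart.vec (spacetimeModel d) (spacetimeBasis d) e ρ j x

/-- The function `μ = ρψ + ψ²`. -/
def mu (ρ : ∀ q : ℝ × N, TangentSpace (spacetimeModel d) q) (ψ : ℝ × N → ℝ) (q : ℝ × N) : ℝ :=
  InChart.along (spacetimeModel d) ρ ψ q + ψ q ^ 2

/-- `f` is the potential function of a gradient `(m,τ)`-quasi Einstein soliton with constant `lam`:
`∇²f + S - (1/m) df ⊗ df = (lam + τ r) g`. -/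
structure IsGradientQES (S : GRWSpacetime d N) (m τ lam : ℝ) (f : ℝ × N → ℝ) : Prop where
  pos : 0 < m
  smooth : ContMDiffOn (spacetimeModel d) 𝓘(ℝ, ℝ) ∞ f S.carrier
  eqn : S.Everywhere fun e x => ∀ i j,
    Coord.hess (spacetimeBasis d) (S.metric e) (InChart.func (spacetimeModel d) e f) i j x
        + Coord.ricci (spacetimeBasis d) (S.metric e) i j x
        - 1 / m * (Coord.pd (spacetimeBasis d) i (InChart.func (spacetimeModel d) e f) x
          * Coord.pd (spacetimeBasis d) j (InChart.func (spacetimeModel d) e f) x)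
      = (lam + τ * Coord.scalar (spacetimeBasis d) (S.metric e) x) * S.metric e x i j

/-- A Robertson-Walker spacetime: the fibre is of dimension three and has constant sectional
curvature. -/
def IsRobertsonWalker {N : Type*} [TopologicalSpace N]
    [ChartedSpace (EuclideanSpace ℝ (Fin 3)) N] [IsManifold (𝓡 3) ∞ N]
    (S : GRWSpacetime 3 N) : Prop :=
  HasConstantSectionalCurvature S.fibreMetric

end GRWSpacetime

end

/-! Write η = g(·, ρ), c = ρf and n for the dimension of spacetime. The torse-forming condition and
the Ricci identity determine R(U,V)ρ. Its trace gives S(·, ρ), and since ρ is a Ricci eigenvector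
the eigenvalue must be (n - 1)μ = β₁ (`sum_ricci_mul_of_eigen`).

Hence contracting the soliton equation with ρ cancels the Ricci term against the right side and
leaves ∇²f(U, ρ) = (c/m) Uf. Differentiating the constant ρf gives instead ∇²f(U, ρ) = -ψ (Uf + c
η(U)). Putting U = ρ in both yields c²/m = 0, so c = 0 and ψ df = 0. Where ψ ≠ 0 this says df = 0;
where ψ = 0, differentiating it along ρ gives (ρψ) df = 0, and there (n - 1) ρψ = β₁ ≠ 0. So df = 0
everywhere and the soliton equation becomes S = β₁ g (`IsTorseFormingOn.ricci_eq_of_soliton`).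

For an Einstein warped product, `ricci_warped_inr_inr` shows that the Ricci tensor of the fibre is a
multiple of g*, with a factor depending on t alone. In dimension three the Ricci tensor determines
the curvature tensor (`eq_of_trace_eq`), so the fibre has constant sectional curvature
(`sectional_eq_of_ricci_eq`). The computation is carried out in product charts, where the spacetime
metric is block diagonal (`metric_prodChart`). -/

namespace Coord

variable {ι : Type*} {E : Type*} [NormedAddCommGroup E] [NormedSpace ℝ E]
  (b : Module.Basis ι ℝ E) {O : Set E} {x : E}

/-! ### Partial derivatives -/

theorem pd_add (i : ι) {h k : E → ℝ} (hh : DifferentiableAt ℝ h x) (hk : DifferentiableAt ℝ k x) :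
    pd b i (fun y => h y + k y) x = pd b i h x + pd b i k x := by
  simp [pd, fderiv_fun_add hh hk]

theorem pd_mul (i : ι) {h k : E → ℝ} (hh : DifferentiableAt ℝ h x) (hk : DifferentiableAt ℝ k x) :
    pd b i (fun y => h y * k y) x = pd b i h x * k x + h x * pd b i k x := by
  simp [pd, fderiv_fun_mul hh hk]; ring

theorem pd_sum {κ : Type*} (s : Finset κ) (i : ι) {h : κ → E → ℝ}
    (hh : ∀ k ∈ s, DifferentiableAt ℝ (h k) x) :
    pd b i (fun y => ∑ k ∈ s, h k y) x = ∑ k ∈ s, pd b i (h k) x := by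
  simp [pd, fderiv_fun_sum hh]

theorem pd_const (i : ι) (c : ℝ) : pd b i (fun _ => c) x = 0 := by
  simp [pd]

theorem pd_congr (hO : IsOpen O) (hx : x ∈ O) (i : ι) {h k : E → ℝ} (hk : ∀ y ∈ O, h y = k y) :
    pd b i h x = pd b i k x := by
  have : h =ᶠ[nhds x] k := Filter.eventually_of_mem (hO.mem_nhds hx) hk
  simp [pd, this.fderiv_eq]

theorem contDiffOn_pd (hO : IsOpen O) (i : ι) {h : E → ℝ} (hh : ContDiffOn ℝ ∞ h O) :
    ContDiffOn ℝ ∞ (pd b i h) O :=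
  (hh.fderiv_of_isOpen hO (m := ∞) le_rfl).clm_apply contDiffOn_const

theorem _root_.ContDiffOn.differentiableAt_of_isOpen (hO : IsOpen O) (hx : x ∈ O) {h : E → ℝ}
    (hh : ContDiffOn ℝ ∞ h O) : DifferentiableAt ℝ h x :=
  (hh.contDiffAt (hO.mem_nhds hx)).differentiableAt (by simp)

theorem pd_comm (hO : IsOpen O) (hx : x ∈ O) (i j : ι) {h : E → ℝ} (hh : ContDiffOn ℝ ∞ h O) :
    pd b i (pd b j h) x = pd b j (pd b i h) x := by
  have hc := hh.contDiffAt (hO.mem_nhds hx)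
  have hs : IsSymmSndFDerivAt ℝ h x := hc.isSymmSndFDerivAt (by simp; norm_cast)
  have hd : DifferentiableAt ℝ (fderiv ℝ h) x :=
    (hc.fderiv_right (m := 1) (by norm_cast)).differentiableAt (by simp)
  have key : ∀ i j, pd b i (pd b j h) x = fderiv ℝ (fderiv ℝ h) x (b i) (b j) := by
    intro i j
    have : pd b j h = fun y => fderiv ℝ h y (b j) := rfl
    rw [this, pd, fderiv_clm_apply hd (differentiableAt_const _)]
    simp
  rw [key, key, hs.eq]

/-! ### The Levi-Civita connection of a smooth nondegenerate metric -/

variable [Fintype ι] [DecidableEq ι] {g : E → Matrix ι ι ℝ}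

/-- `g` is the matrix of a smooth semi-Riemannian metric on the open set `O`. -/
structure IsMetricOn (g : E → Matrix ι ι ℝ) (O : Set E) : Prop where
  isOpen : IsOpen O
  smooth : ∀ i j, ContDiffOn ℝ ∞ (fun y => g y i j) O
  symm : ∀ y ∈ O, ∀ i j, g y i j = g y j i
  det_ne_zero : ∀ y ∈ O, (g y).det ≠ 0

theorem contDiffOn_det {A : E → Matrix ι ι ℝ} (hA : ∀ i j, ContDiffOn ℝ ∞ (fun y => A y i j) O) :
    ContDiffOn ℝ ∞ (fun y => (A y).det) O := by
  simp only [Matrix.det_apply]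
  refine ContDiffOn.sum fun σ _ => ?_
  exact (contDiffOn_prod fun i _ => hA (σ i) i).const_smul _

namespace IsMetricOn

/-- Cramer's rule: an entry of the inverse is a determinant with one row replaced by a unit vector,
divided by the nonvanishing determinant of `g`. -/
theorem contDiffOn_inv (hg : IsMetricOn g O) (i j : ι) :
    ContDiffOn ℝ ∞ (fun y => (g y)⁻¹ i j) O := by
  have h1 : (fun y => (g y)⁻¹ i j) =
      fun y => ((g y).det)⁻¹ * ((g y).updateRow j (Pi.single i 1)).det := by
    funext y
    simp [Matrix.inv_def, Matrix.adjugate_apply]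
  rw [h1]
  refine ((contDiffOn_det hg.smooth).inv hg.det_ne_zero).mul (contDiffOn_det fun k l => ?_)
  by_cases hk : k = j
  · subst hk; simpa using contDiffOn_const
  · simpa [Matrix.updateRow_ne hk] using hg.smooth k l

theorem contDiffOn_christoffel (hg : IsMetricOn g O) (k i j : ι) :
    ContDiffOn ℝ ∞ (christoffel b g k i j) O := by
  unfold christoffel
  refine contDiffOn_const.mul (ContDiffOn.sum fun l _ => (hg.contDiffOn_inv k l).mul ?_)
  exact ((contDiffOn_pd b hg.isOpen _ (hg.smooth _ _)).add
    (contDiffOn_pd b hg.isOpen _ (hg.smooth _ _))).sub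
    (contDiffOn_pd b hg.isOpen _ (hg.smooth _ _))

theorem pd_symm (hg : IsMetricOn g O) (hx : x ∈ O) (i j k : ι) :
    pd b i (fun y => g y j k) x = pd b i (fun y => g y k j) x :=
  pd_congr b hg.isOpen hx i fun y hy => hg.symm y hy j k

theorem christoffel_symm (hg : IsMetricOn g O) (hx : x ∈ O) (k i j : ι) :
    christoffel b g k i j x = christoffel b g k j i x := by
  unfold christoffel
  congr 1
  refine Finset.sum_congr rfl fun l _ => ?_
  rw [hg.pd_symm b hx l i j]
  ring

theorem sum_christoffel (hg : IsMetricOn g O) (hx : x ∈ O) (l i j : ι) :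
    ∑ k, christoffel b g k i j x * g x k l
      = 1 / 2 * (pd b i (fun y => g y j l) x + pd b j (fun y => g y i l) x
        - pd b l (fun y => g y i j) x) := by
  unfold christoffel
  simp only [mul_assoc, Finset.sum_mul, Finset.mul_sum]
  rw [Finset.sum_comm]
  have h1 : ∀ s, ∑ k, g x l k * (g x)⁻¹ k s = if l = s then 1 else 0 := by
    intro s
    have := congrFun (congrFun (Matrix.mul_nonsing_inv (g x)
      (isUnit_iff_ne_zero.mpr (hg.det_ne_zero x hx))) l) s
    rwa [Matrix.mul_apply, Matrix.one_apply] at this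
  have h2 : ∀ s (c : ℝ), ∑ k, (1 / 2 * ((g x)⁻¹ k s * (c * g x k l)))
      = 1 / 2 * c * (if l = s then 1 else 0) := by
    intro s c
    rw [← h1 s, Finset.mul_sum]
    refine Finset.sum_congr rfl fun k _ => ?_
    rw [hg.symm x hx l k]; ring
  simp only [h2]
  simp

/-- Metric compatibility, ∇g = 0. In the sum of the two lowered Christoffel symbols the other
derivatives of the metric cancel. -/
theorem pd_metric (hg : IsMetricOn g O) (hx : x ∈ O) (i j k : ι) :
    pd b i (fun y => g y j k) x
      = ∑ s, christoffel b g s i j x * g x s k + ∑ s, christoffel b g s i k x * g x s j := by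
  rw [hg.sum_christoffel b hx, hg.sum_christoffel b hx, hg.pd_symm b hx i k j,
    hg.pd_symm b hx k i j, hg.pd_symm b hx j i k]
  ring

/-- The Ricci identity for a vector field. -/
theorem sum_riemann_mul (hg : IsMetricOn g O) (hx : x ∈ O) {ρ : ι → E → ℝ}
    (hρ : ∀ i, ContDiffOn ℝ ∞ (ρ i) O) (k i j : ι) :
    ∑ l, riemann b g k i j l x * ρ l x
      = pd b i (covDeriv b g ρ j k) x - pd b j (covDeriv b g ρ i k) x
        + (∑ s, christoffel b g k i s x * covDeriv b g ρ j s x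
          - ∑ s, christoffel b g k j s x * covDeriv b g ρ i s x) := by
  have dΓ : ∀ k i j, DifferentiableAt ℝ (christoffel b g k i j) x := fun k i j =>
    (hg.contDiffOn_christoffel b k i j).differentiableAt_of_isOpen hg.isOpen hx
  have dρ : ∀ i, DifferentiableAt ℝ (ρ i) x := fun i =>
    (hρ i).differentiableAt_of_isOpen hg.isOpen hx
  have dpρ : ∀ i j, DifferentiableAt ℝ (pd b i (ρ j)) x := fun i j =>
    (contDiffOn_pd b hg.isOpen i (hρ j)).differentiableAt_of_isOpen hg.isOpen hx
  have h1 : ∀ i j, pd b i (covDeriv b g ρ j k) x = pd b i (pd b j (ρ k)) x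
      + ∑ l, (pd b i (christoffel b g k j l) x * ρ l x
        + christoffel b g k j l x * pd b i (ρ l) x) := by
    intro i j
    have : covDeriv b g ρ j k = fun y => pd b j (ρ k) y + ∑ l, christoffel b g k j l y * ρ l y :=
      rfl
    rw [this, pd_add b i (dpρ _ _) (DifferentiableAt.fun_sum fun l _ => (dΓ k j l).fun_mul (dρ l)),
      pd_sum b _ i fun l _ => (dΓ k j l).fun_mul (dρ l)]
    congr 1
    exact Finset.sum_congr rfl fun l _ => pd_mul b i (dΓ _ _ _) (dρ _)
  have h2 : ∀ i j, ∑ s, christoffel b g k i s x * covDeriv b g ρ j s x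
      = ∑ s, christoffel b g k i s x * pd b j (ρ s) x
        + ∑ l, (∑ s, christoffel b g k i s x * christoffel b g s j l x) * ρ l x := by
    intro i j
    simp only [covDeriv, mul_add, Finset.sum_add_distrib, Finset.mul_sum, Finset.sum_mul]
    congr 1
    rw [Finset.sum_comm]
    simp only [mul_assoc]
  rw [h1, h1, h2, h2, pd_comm b hg.isOpen hx i j (hρ k)]
  simp only [riemann, Finset.sum_sub_distrib, add_mul, sub_mul, Finset.sum_add_distrib]
  ring

end IsMetricOn

/-! ### Torse-forming vector fields -/

/-- The vector field with components `ρ` on `O` is unit timelike and torse-forming. -/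
structure IsTorseFormingOn (g : E → Matrix ι ι ℝ) (ρ : ι → E → ℝ) (ψ : E → ℝ) (O : Set E) :
    Prop where
  smooth : ∀ i, ContDiffOn ℝ ∞ (ρ i) O
  smooth_coeff : ContDiffOn ℝ ∞ ψ O
  unit : ∀ y ∈ O, ∑ i, ∑ j, g y i j * ρ i y * ρ j y = -1
  torse : ∀ y ∈ O, ∀ i k, covDeriv b g ρ i k y
    = ψ y * ((if i = k then 1 else 0) + (∑ j, g y i j * ρ j y) * ρ k y)

namespace IsTorseFormingOn

variable {b} {ρ : ι → E → ℝ} {ψ : E → ℝ}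

theorem sum_lower_mul (hρ : IsTorseFormingOn b g ρ ψ O) (hx : x ∈ O) :
    ∑ i, (∑ j, g x i j * ρ j x) * ρ i x = -1 := by
  rw [← hρ.unit x hx]
  refine Finset.sum_congr rfl fun i _ => ?_
  rw [Finset.sum_mul]
  exact Finset.sum_congr rfl fun j _ => by ring

/-- In invariant form, ∇η = ψ (g + η ⊗ η): as ∇g = 0, the index in the torse-forming equation may be
lowered. -/
theorem pd_lower (hg : IsMetricOn g O) (hρ : IsTorseFormingOn b g ρ ψ O) (hx : x ∈ O) (i j : ι) :
    pd b i (fun y => ∑ k, g y j k * ρ k y) x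
      = ∑ s, christoffel b g s i j x * (∑ k, g x s k * ρ k x)
        + ψ x * (g x i j + (∑ k, g x i k * ρ k x) * (∑ k, g x j k * ρ k x)) := by
  have dg : ∀ i j, DifferentiableAt ℝ (fun y => g y i j) x := fun i j =>
    (hg.smooth i j).differentiableAt_of_isOpen hg.isOpen hx
  have dρ : ∀ i, DifferentiableAt ℝ (ρ i) x := fun i =>
    (hρ.smooth i).differentiableAt_of_isOpen hg.isOpen hx
  rw [pd_sum b _ i fun k _ => (dg j k).fun_mul (dρ k)]
  have h1 : ∀ k, pd b i (fun y => g y j k * ρ k y) x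
      = (∑ s, christoffel b g s i j x * g x s k) * ρ k x
        + (∑ s, christoffel b g s i k x * g x s j) * ρ k x + g x j k * pd b i (ρ k) x := by
    intro k
    rw [pd_mul b i (dg j k) (dρ k), hg.pd_metric b hx]; ring
  have h2 : ∀ k, pd b i (ρ k) x = ψ x * ((if i = k then 1 else 0)
      + (∑ j, g x i j * ρ j x) * ρ k x) - ∑ l, christoffel b g k i l x * ρ l x := by
    intro k
    rw [← hρ.torse x hx]; simp [covDeriv]
  simp only [h1, Finset.sum_add_distrib]
  have e1 : ∑ k, (∑ s, christoffel b g s i j x * g x s k) * ρ k x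
      = ∑ s, christoffel b g s i j x * (∑ k, g x s k * ρ k x) := by
    simp only [Finset.sum_mul, Finset.mul_sum]
    rw [Finset.sum_comm]
    simp only [mul_assoc]
  have e2 : ∑ k, g x j k * pd b i (ρ k) x
      = ψ x * (g x i j + (∑ k, g x i k * ρ k x) * (∑ k, g x j k * ρ k x))
        - ∑ k, (∑ s, christoffel b g s i k x * g x s j) * ρ k x := by
    set η := ∑ j, g x i j * ρ j x with hη
    have : ∀ k, g x j k * pd b i (ρ k) x = ψ x * (g x j k * (if i = k then 1 else 0))
        + ψ x * (η * (g x j k * ρ k x))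
        - ∑ l, christoffel b g k i l x * g x k j * ρ l x := by
      intro k
      rw [h2 k, hg.symm x hx k j]
      simp only [mul_sub, Finset.mul_sum]
      congr 1
      · ring
      · exact Finset.sum_congr rfl fun l _ => by ring
    simp only [this, Finset.sum_sub_distrib, Finset.sum_add_distrib, ← Finset.mul_sum]
    rw [Finset.sum_comm (f := fun k l => christoffel b g k i l x * g x k j * ρ l x)]
    simp only [← Finset.sum_mul]
    simp [hg.symm x hx j i]
    ring
  rw [e1, e2]; ring

/-- `R(U,V)ρ = (Uψ)(V + η(V)ρ) - (Vψ)(U + η(U)ρ) + ψ² (η(V)U - η(U)V)`. -/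
theorem sum_riemann_mul (hg : IsMetricOn g O) (hρ : IsTorseFormingOn b g ρ ψ O) (hx : x ∈ O)
    (k i j : ι) :
    ∑ l, riemann b g k i j l x * ρ l x
      = pd b i ψ x * ((if j = k then 1 else 0) + (∑ l, g x j l * ρ l x) * ρ k x)
        - pd b j ψ x * ((if i = k then 1 else 0) + (∑ l, g x i l * ρ l x) * ρ k x)
        + ψ x ^ 2 * ((∑ l, g x j l * ρ l x) * (if i = k then 1 else 0)
          - (∑ l, g x i l * ρ l x) * (if j = k then 1 else 0)) := by
  have dρ : ∀ i, DifferentiableAt ℝ (ρ i) x := fun i =>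
    (hρ.smooth i).differentiableAt_of_isOpen hg.isOpen hx
  have dψ : DifferentiableAt ℝ ψ x := hρ.smooth_coeff.differentiableAt_of_isOpen hg.isOpen hx
  have dη : ∀ j, DifferentiableAt ℝ (fun y => ∑ k, g y j k * ρ k y) x := fun j =>
    DifferentiableAt.fun_sum fun k _ =>
      ((hg.smooth j k).differentiableAt_of_isOpen hg.isOpen hx).mul (dρ k)
  have h1 : ∀ i j, pd b i (covDeriv b g ρ j k) x
      = pd b i ψ x * ((if j = k then 1 else 0) + (∑ l, g x j l * ρ l x) * ρ k x)
        + ψ x * (pd b i (fun y => ∑ k, g y j k * ρ k y) x * ρ k x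
          + (∑ l, g x j l * ρ l x) * pd b i (ρ k) x) := by
    intro i j
    rw [pd_congr b hg.isOpen hx i fun y hy => hρ.torse y hy j k,
      pd_mul b i dψ (((differentiableAt_const _).fun_add ((dη j).fun_mul (dρ k)))),
      pd_add b i (differentiableAt_const _) ((dη j).fun_mul (dρ k)), pd_const,
      pd_mul b i (dη j) (dρ k)]
    ring
  have h2 : ∀ i, pd b i (ρ k) x = ψ x * ((if i = k then 1 else 0)
      + (∑ j, g x i j * ρ j x) * ρ k x) - ∑ l, christoffel b g k i l x * ρ l x := by
    intro i
    rw [← hρ.torse x hx]; simp [covDeriv]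
  have h3 : ∀ i j, ∑ s, christoffel b g k i s x * covDeriv b g ρ j s x
      = ψ x * (christoffel b g k i j x
        + (∑ l, g x j l * ρ l x) * ∑ s, christoffel b g k i s x * ρ s x) := by
    intro i j
    simp only [hρ.torse x hx]
    set η := ∑ l, g x j l * ρ l x
    have : ∀ s, christoffel b g k i s x * (ψ x * ((if j = s then 1 else 0) + η * ρ s x))
        = ψ x * (christoffel b g k i s x * (if j = s then 1 else 0))
          + ψ x * (η * (christoffel b g k i s x * ρ s x)) := fun s => by ring
    simp only [this, Finset.sum_add_distrib, ← Finset.mul_sum]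
    simp
    ring
  -- In the Ricci identity ∇η enters antisymmetrized, and it is symmetric, so it drops out. Only the
  -- dψ terms and the ψ² terms coming from η ⊗ ∇ρ survive.
  rw [hg.sum_riemann_mul b hx hρ.smooth, h1, h1, h3, h3, h2, h2, hρ.pd_lower hg hx,
    hρ.pd_lower hg hx, hg.christoffel_symm b hx k j i, hg.symm x hx j i]
  simp only [hg.christoffel_symm b hx _ j i]
  ring

/-- `S(V,ρ) = (2 - n) Vψ + (ρψ + (n - 1) ψ²) η(V)`. -/
theorem sum_ricci_mul (hg : IsMetricOn g O) (hρ : IsTorseFormingOn b g ρ ψ O) (hx : x ∈ O)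
    (j : ι) :
    ∑ l, ricci b g j l x * ρ l x
      = (2 - Fintype.card ι) * pd b j ψ x
        + (∑ i, ρ i x * pd b i ψ x + (Fintype.card ι - 1) * ψ x ^ 2)
          * ∑ l, g x j l * ρ l x := by
  have h0 := hρ.sum_lower_mul hx
  have h1 : ∑ l, ricci b g j l x * ρ l x = ∑ i, ∑ l, riemann b g i i j l x * ρ l x := by
    simp only [ricci, Finset.sum_mul]
    exact Finset.sum_comm
  rw [h1]
  rw [Finset.sum_congr rfl fun i _ => hρ.sum_riemann_mul hg hx i i j]
  set η : ι → ℝ := fun i => ∑ l, g x i l * ρ l x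
  change ∑ i, η i * ρ i x = -1 at h0
  -- Regroups the summand so that each part sums to something known: a Kronecker delta, η(ρ) = -1,
  -- or ρψ.
  have h2 : ∀ i, pd b i ψ x * ((if j = i then 1 else 0) + η j * ρ i x)
      - pd b j ψ x * ((if i = i then 1 else 0) + η i * ρ i x)
      + ψ x ^ 2 * (η j * (if i = i then 1 else 0) - η i * (if j = i then 1 else 0))
      = (pd b i ψ x * (if j = i then 1 else 0) + η j * (ρ i x * pd b i ψ x))
        - (pd b j ψ x * 1 + pd b j ψ x * (η i * ρ i x))
        + (ψ x ^ 2 * η j * 1 - ψ x ^ 2 * (η i * (if j = i then 1 else 0))) := by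
    intro i; rw [if_pos rfl]; ring
  change ∑ i, (pd b i ψ x * ((if j = i then 1 else 0) + η j * ρ i x)
      - pd b j ψ x * ((if i = i then 1 else 0) + η i * ρ i x)
      + ψ x ^ 2 * (η j * (if i = i then 1 else 0) - η i * (if j = i then 1 else 0))) = _ + _ * η j
  rw [Finset.sum_congr rfl fun i _ => h2 i]
  simp only [Finset.sum_add_distrib, Finset.sum_sub_distrib, ← Finset.mul_sum, h0]
  simp
  ring

/-- If `ρ` is an eigenvector of the Ricci tensor, the eigenvalue is `(n - 1)(ρψ + ψ²)`. -/
theorem sum_ricci_mul_of_eigen (hg : IsMetricOn g O) (hρ : IsTorseFormingOn b g ρ ψ O)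
    (hx : x ∈ O) {ξ : ℝ}
    (hξ : ∀ j, ∑ l, ricci b g j l x * ρ l x = ξ * ∑ l, g x j l * ρ l x) (j : ι) :
    ∑ l, ricci b g j l x * ρ l x
      = ((Fintype.card ι - 1) * (∑ i, ρ i x * pd b i ψ x + ψ x ^ 2)) * ∑ l, g x j l * ρ l x := by
  have h0 := hρ.sum_lower_mul hx
  -- S(ρ, ρ) = ξ η(ρ) = -ξ. Comparing with the general formula for S(·, ρ) at ρ gives ξ, so there is
  -- no need to show that dψ is proportional to η.
  have h1 : ∑ j, (∑ l, ricci b g j l x * ρ l x) * ρ j x = -ξ := by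
    simp only [hξ, mul_assoc, ← Finset.mul_sum, h0]; ring
  simp only [hρ.sum_ricci_mul hg hx] at h1
  have h2 : ∀ (A B : ℝ) (η : ι → ℝ), ∑ j, (A * pd b j ψ x + B * η j) * ρ j x
      = A * ∑ i, ρ i x * pd b i ψ x + B * ∑ j, η j * ρ j x := by
    intro A B η
    simp only [Finset.mul_sum, ← Finset.sum_add_distrib]
    exact Finset.sum_congr rfl fun i _ => by ring
  rw [h2, h0] at h1
  rw [hξ j]
  congr 1
  linarith

/-! ### Quasi Einstein solitons -/

/-- A gradient quasi Einstein soliton with `β = (n - 1) μ ≠ 0` and `ρ f` constant is Einstein. -/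
theorem ricci_eq_of_soliton (hg : IsMetricOn g O) (hρ : IsTorseFormingOn b g ρ ψ O)
    (hξ : ∀ y ∈ O, ∃ ξ : ℝ, ∀ j,
      ∑ l, ricci b g j l y * ρ l y = ξ * ∑ l, g y j l * ρ l y)
    {m β c : ℝ} (hm : m ≠ 0) (hβ : β ≠ 0) {f : E → ℝ} (hf : ContDiffOn ℝ ∞ f O)
    (hsol : ∀ y ∈ O, ∀ i j, hess b g f i j y + ricci b g i j y
      - 1 / m * (pd b i f y * pd b j f y) = β * g y i j)
    (hμ : ∀ y ∈ O, β = (Fintype.card ι - 1) * (∑ i, ρ i y * pd b i ψ y + ψ y ^ 2))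
    (hc : ∀ y ∈ O, ∑ i, ρ i y * pd b i f y = c)
    (hx : x ∈ O) (i j : ι) : ricci b g i j x = β * g x i j := by
  have hO := hg.isOpen
  have dρ : ∀ x ∈ O, ∀ i, DifferentiableAt ℝ (ρ i) x := fun x hx i =>
    (hρ.smooth i).differentiableAt_of_isOpen hO hx
  have dpf : ∀ x ∈ O, ∀ i, DifferentiableAt ℝ (pd b i f) x := fun x hx i =>
    (contDiffOn_pd b hO i hf).differentiableAt_of_isOpen hO hx
  -- Differentiate ρf = c: 0 = (∇_U ρ)f + ∇²f(U, ρ), and the first term is known from the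
  -- torse-forming equation.
  have hess_mul : ∀ x ∈ O, ∀ i, ∑ j, hess b g f i j x * ρ j x
      = -(ψ x * (pd b i f x + c * ∑ l, g x i l * ρ l x)) := by
    intro x hx i
    have e1 : ∑ j, (pd b i (ρ j) x * pd b j f x + ρ j x * pd b i (pd b j f) x) = 0 := by
      have := pd_congr b hO hx i hc
      rw [pd_const, pd_sum b _ i fun j _ => (dρ x hx j).fun_mul (dpf x hx j)] at this
      rw [← this]
      exact Finset.sum_congr rfl fun j _ => (pd_mul b i (dρ x hx j) (dpf x hx j)).symm
    have e2 : ∑ k, covDeriv b g ρ i k x * pd b k f x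
        = ψ x * (pd b i f x + c * ∑ l, g x i l * ρ l x) := by
      simp only [hρ.torse x hx]
      rw [← hc x hx]
      set η := ∑ l, g x i l * ρ l x
      have : ∀ k, ψ x * ((if i = k then 1 else 0) + η * ρ k x) * pd b k f x
          = ψ x * ((if i = k then 1 else 0) * pd b k f x)
            + ψ x * (η * (ρ k x * pd b k f x)) := fun k => by ring
      simp only [this, Finset.sum_add_distrib, ← Finset.mul_sum]
      simp
      ring
    rw [← e2]
    simp only [covDeriv, hess, sub_mul, add_mul, Finset.sum_mul, Finset.sum_sub_distrib,
      Finset.sum_add_distrib] at e1 ⊢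
    rw [Finset.sum_comm]
    have e3 : ∑ j, pd b i (pd b j f) x * ρ j x = ∑ j, ρ j x * pd b i (pd b j f) x :=
      Finset.sum_congr rfl fun j _ => mul_comm _ _
    have e4 : ∀ k, ∑ j, christoffel b g k i j x * pd b k f x * ρ j x
        = ∑ j, christoffel b g k i j x * ρ j x * pd b k f x := fun k =>
      Finset.sum_congr rfl fun j _ => by ring
    simp only [e3, e4]
    linarith
  -- The soliton equation contracted with ρ; the term S(·, ρ) = β η cancels the right side.
  have sol_mul : ∀ x ∈ O, ∀ i, ∑ j, hess b g f i j x * ρ j x = 1 / m * (c * pd b i f x) := by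
    intro x hx i
    obtain ⟨ξ, hξ⟩ := hξ x hx
    have e1 := hρ.sum_ricci_mul_of_eigen hg hx hξ i
    rw [← hμ x hx] at e1
    have e2 : ∑ j, (hess b g f i j x + ricci b g i j x
        - 1 / m * (pd b i f x * pd b j f x)) * ρ j x = ∑ j, (β * g x i j) * ρ j x :=
      Finset.sum_congr rfl fun j _ => by rw [hsol x hx]
    have e3 : ∑ j, 1 / m * (pd b i f x * pd b j f x) * ρ j x = 1 / m * (c * pd b i f x) := by
      rw [← hc x hx, Finset.sum_mul, Finset.mul_sum]
      exact Finset.sum_congr rfl fun j _ => by ring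
    have e4 : ∑ j, (β * g x i j) * ρ j x = β * ∑ j, g x i j * ρ j x := by
      rw [Finset.mul_sum]
      exact Finset.sum_congr rfl fun j _ => by ring
    simp only [sub_mul, add_mul, Finset.sum_sub_distrib, Finset.sum_add_distrib] at e2
    rw [e1, e3, e4] at e2
    linarith
  -- Both expressions for ∇²f(ρ, ρ): c²/m = -ψ (c + c η(ρ)), which vanishes because η(ρ) = -1.
  have hc0 : c = 0 := by
    have e1 : ∑ i, (1 / m * (c * pd b i f x)) * ρ i x
        = ∑ i, (-(ψ x * (pd b i f x + c * ∑ l, g x i l * ρ l x))) * ρ i x :=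
      Finset.sum_congr rfl fun i _ => by rw [← sol_mul x hx, hess_mul x hx]
    have e2 : ∑ i, (1 / m * (c * pd b i f x)) * ρ i x = 1 / m * c * c := by
      have : ∑ i, (1 / m * (c * pd b i f x)) * ρ i x
          = 1 / m * c * ∑ i, ρ i x * pd b i f x := by
        rw [Finset.mul_sum]
        exact Finset.sum_congr rfl fun j _ => by ring
      rw [this, hc x hx]
    have e3 : ∑ i, (-(ψ x * (pd b i f x + c * ∑ l, g x i l * ρ l x))) * ρ i x
        = -(ψ x * (∑ i, ρ i x * pd b i f x
          + c * ∑ i, (∑ l, g x i l * ρ l x) * ρ i x)) := by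
      have : ∀ i, (-(ψ x * (pd b i f x + c * ∑ l, g x i l * ρ l x))) * ρ i x
          = -ψ x * (ρ i x * pd b i f x) + -(ψ x * c) * ((∑ l, g x i l * ρ l x) * ρ i x) :=
        fun i => by ring
      rw [Finset.sum_congr rfl fun i _ => this i, Finset.sum_add_distrib, ← Finset.mul_sum,
        ← Finset.mul_sum]
      ring
    rw [e2, e3, hc x hx, hρ.sum_lower_mul hx] at e1
    have : 1 / m * c * c = 0 := by rw [e1]; ring
    simpa [hm] using this
  have hψ : ∀ y ∈ O, ∀ i, ψ y * pd b i f y = 0 := by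
    intro y hy i
    have := hess_mul y hy i
    rw [sol_mul y hy, hc0] at this
    simpa using this
  have hf0 : ∀ y ∈ O, ∀ i, pd b i f y = 0 := by
    intro y hy i
    -- At a zero of ψ the product rule turns ψ df = 0 into dψ ⊗ df = 0. There β = (n - 1) ρψ, so β
    -- df = 0 as well.
    by_cases h0 : ψ y = 0
    · have e1 : ∀ k, pd b k ψ y * pd b i f y = 0 := by
        intro k
        have := pd_congr b hO hy k fun z hz => hψ z hz i
        rw [pd_const, pd_mul b k (hρ.smooth_coeff.differentiableAt_of_isOpen hO hy)
          (dpf y hy i), h0] at this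
        simpa using this
      have e2 : β * pd b i f y = 0 := by
        rw [hμ y hy, h0]
        have : (∑ k, ρ k y * pd b k ψ y) * pd b i f y = 0 := by
          rw [Finset.sum_mul]
          exact Finset.sum_eq_zero fun k _ => by rw [mul_assoc, e1, mul_zero]
        linear_combination (Fintype.card ι - 1 : ℝ) * this
      exact (mul_eq_zero.mp e2).resolve_left hβ
    · exact (mul_eq_zero.mp (hψ y hy i)).resolve_left h0
  have hh : hess b g f i j x = 0 := by
    have : pd b i (pd b j f) x = 0 := by
      rw [pd_congr b hO hx i fun y hy => hf0 y hy j, pd_const]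
    simp [hess, this, hf0 x hx]
  have := hsol x hx i j
  rw [hh, hf0 x hx i] at this
  linarith

end IsTorseFormingOn

/-! ### Dependence on the metric and antisymmetry of the curvature tensor -/

section

variable {ι : Type*} [Fintype ι] [DecidableEq ι] {E : Type*} [NormedAddCommGroup E]
  [NormedSpace ℝ E] (b : Module.Basis ι ℝ E) {g g' : E → Matrix ι ι ℝ} {O : Set E} {x : E}

theorem christoffel_congr (hO : IsOpen O) (h : ∀ y ∈ O, g y = g' y) (hx : x ∈ O) (k i j : ι) :
    christoffel b g k i j x = christoffel b g' k i j x := by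
  have hp : ∀ i j k, pd b i (fun y => g y j k) x = pd b i (fun y => g' y j k) x := fun i j k =>
    pd_congr b hO hx i fun y hy => by rw [h y hy]
  simp only [christoffel, hp, h x hx]

theorem ricci_congr (hO : IsOpen O) (h : ∀ y ∈ O, g y = g' y) (hx : x ∈ O) (j k : ι) :
    ricci b g j k x = ricci b g' j k x := by
  have hp : ∀ i l j k, pd b i (christoffel b g l j k) x = pd b i (christoffel b g' l j k) x :=
    fun i l j k => pd_congr b hO hx i fun y hy => christoffel_congr b hO h hy l j k
  simp only [ricci, riemann, hp, christoffel_congr b hO h hx]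

namespace IsMetricOn

/-- Metric compatibility lets the lowering pass through the derivative. In this form the terms are
derivatives of lowered Christoffel symbols and inner products of Christoffel symbols, from which the
antisymmetry in the last pair can be read off. -/
theorem sum_riemann_lower (hg : IsMetricOn g O) (hx : x ∈ O) (i j k l : ι) :
    ∑ s, riemann b g s i j k x * g x s l
      = (pd b i (fun y => ∑ s, christoffel b g s j k y * g y s l) x
          - ∑ s, ∑ t, christoffel b g s j k x * christoffel b g t i l x * g x s t)
        - (pd b j (fun y => ∑ s, christoffel b g s i k y * g y s l) x
          - ∑ s, ∑ t, christoffel b g s i k x * christoffel b g t j l x * g x s t) := by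
  have dΓ : ∀ k i j, DifferentiableAt ℝ (christoffel b g k i j) x := fun k i j =>
    (hg.contDiffOn_christoffel b k i j).differentiableAt_of_isOpen hg.isOpen hx
  have dg : ∀ i j, DifferentiableAt ℝ (fun y => g y i j) x := fun i j =>
    (hg.smooth i j).differentiableAt_of_isOpen hg.isOpen hx
  have key : ∀ i j, pd b i (fun y => ∑ s, christoffel b g s j k y * g y s l) x
      - ∑ s, ∑ t, christoffel b g s j k x * christoffel b g t i l x * g x s t
      = ∑ s, pd b i (christoffel b g s j k) x * g x s l
        + ∑ s, (∑ t, christoffel b g s i t x * christoffel b g t j k x) * g x s l := by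
    intro i j
    rw [pd_sum b _ i fun s _ => (dΓ s j k).fun_mul (dg s l)]
    have h1 : ∀ s, pd b i (fun y => christoffel b g s j k y * g y s l) x
        = pd b i (christoffel b g s j k) x * g x s l
          + ∑ t, christoffel b g t i s x * christoffel b g s j k x * g x t l
          + ∑ t, christoffel b g s j k x * christoffel b g t i l x * g x s t := by
      intro s
      rw [pd_mul b i (dΓ s j k) (dg s l), hg.pd_metric b hx, mul_add, Finset.mul_sum,
        Finset.mul_sum, ← add_assoc]
      congr 1
      · congr 1
        exact Finset.sum_congr rfl fun t _ => by ring
      · refine Finset.sum_congr rfl fun t _ => ?_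
        rw [hg.symm x hx t s]; ring
    rw [Finset.sum_congr rfl fun s _ => h1 s]
    simp only [Finset.sum_add_distrib, Finset.sum_mul]
    rw [Finset.sum_comm (f := fun s t => christoffel b g t i s x * christoffel b g s j k x
      * g x t l)]
    ring
  rw [key, key]
  simp only [riemann, add_mul, sub_mul, Finset.sum_add_distrib, Finset.sum_sub_distrib]
  ring

/-- When k and l are exchanged and the results added, the quadratic terms cancel by symmetry of g.
By ∇g = 0 the derivative terms add up to ∂ᵢ∂ⱼ gₖₗ - ∂ⱼ∂ᵢ gₖₗ = 0. -/
theorem sum_riemann_lower_antisymm (hg : IsMetricOn g O) (hx : x ∈ O) (i j k l : ι) :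
    ∑ s, riemann b g s i j k x * g x s l = -∑ s, riemann b g s i j l x * g x s k := by
  have dF : ∀ j k l, DifferentiableAt ℝ (fun y => ∑ s, christoffel b g s j k y * g y s l) x :=
    fun j k l => DifferentiableAt.fun_sum fun s _ =>
      ((hg.contDiffOn_christoffel b s j k).differentiableAt_of_isOpen hg.isOpen hx).fun_mul
        ((hg.smooth s l).differentiableAt_of_isOpen hg.isOpen hx)
  have h1 : ∀ i j, pd b i (pd b j fun y => g y k l) x
      = pd b i (fun y => ∑ s, christoffel b g s j k y * g y s l) x
        + pd b i (fun y => ∑ s, christoffel b g s j l y * g y s k) x := by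
    intro i j
    rw [← pd_add b i (dF j k l) (dF j l k)]
    exact pd_congr b hg.isOpen hx i fun y hy => hg.pd_metric b hy j k l
  have h2 : ∀ i j k l, ∑ s, ∑ t, christoffel b g s j k x * christoffel b g t i l x * g x s t
      = ∑ s, ∑ t, christoffel b g s i l x * christoffel b g t j k x * g x s t := by
    intro i j k l
    rw [Finset.sum_comm]
    refine Finset.sum_congr rfl fun s _ => Finset.sum_congr rfl fun t _ => ?_
    rw [hg.symm x hx s t]; ring
  have h3 := pd_comm b hg.isOpen hx i j (hg.smooth k l)
  rw [h1, h1] at h3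
  rw [hg.sum_riemann_lower b hx, hg.sum_riemann_lower b hx, h2 i j k l, h2 i j l k]
  linarith

end IsMetricOn

end

/-! ### Einstein metrics in dimension three -/

/-- In dimension three, the trace on `Λ² ⊗ Λ²` given by a nondegenerate form is injective. -/
theorem eq_zero_of_trace_eq_zero {H : Matrix (Fin 3) (Fin 3) ℝ} (hH : H.det ≠ 0)
    (hs : ∀ i j, H i j = H j i) {D : Fin 3 → Fin 3 → Fin 3 → Fin 3 → ℝ}
    (h₁ : ∀ i j k l, D i j k l = -D j i k l) (h₂ : ∀ i j k l, D i j k l = -D i j l k)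
    (h : ∀ j k, ∑ i, ∑ l, H i l * D i j k l = 0) (i j k l : Fin 3) : D i j k l = 0 := by
  have d1 : ∀ i k l, D i i k l = 0 := fun i k l => by linarith [h₁ i i k l]
  have d2 : ∀ i j k, D i j k k = 0 := fun i j k => by linarith [h₂ i j k k]
  have a1 := fun k l => h₁ 1 0 k l
  have a2 := fun k l => h₁ 2 0 k l
  have a3 := fun k l => h₁ 2 1 k l
  have b1 := fun i j => h₂ i j 1 0
  have b2 := fun i j => h₂ i j 2 0
  have b3 := fun i j => h₂ i j 2 1
  -- The pairs (p + 1, p + 2) modulo 3 index a basis of Λ², so D amounts to nine numbers. The trace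
  -- is linear in them, and the right side is its explicit left inverse multiplied by det H.
  have key : ∀ p q, H.det * D (p + 1) (p + 2) (q + 1) (q + 2)
      = ∑ r, ∑ s, (H r q * H p s - 1 / 2 * H r s * H p q) * ∑ i, ∑ l, H i l * D i r s l := by
    intro p q
    fin_cases p <;> fin_cases q <;>
      simp [Fin.sum_univ_three, Matrix.det_fin_three, a1, a2, a3, b1, b2, b3, d1, d2, hs 1 0,
        hs 2 0, hs 2 1] <;> ring
  simp only [h, mul_zero, Finset.sum_const_zero, mul_eq_zero, hH, false_or] at key
  have e00 := key 0 0
  have e01 := key 0 1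
  have e02 := key 0 2
  have e10 := key 1 0
  have e11 := key 1 1
  have e12 := key 1 2
  have e20 := key 2 0
  have e21 := key 2 1
  have e22 := key 2 2
  -- For p = 1 the pair is (2, 0), and it has to be brought to the order (0, 2).
  simp [a2, b2] at e00 e01 e02 e10 e11 e12 e20 e21 e22
  fin_cases i <;> fin_cases j <;> fin_cases k <;> fin_cases l <;>
    simp [a1, a2, a3, b1, b2, b3, d1, d2, e00, e01, e02, e10, e11, e12, e20, e21, e22]

/-- In dimension three, the curvature tensor of an Einstein metric. -/
theorem eq_of_trace_eq {G : Matrix (Fin 3) (Fin 3) ℝ} (hG : G.det ≠ 0)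
    (hs : ∀ i j, G i j = G j i) {B : Fin 3 → Fin 3 → Fin 3 → Fin 3 → ℝ}
    (h₁ : ∀ i j k l, B i j k l = -B j i k l) (h₂ : ∀ i j k l, B i j k l = -B i j l k) {c : ℝ}
    (h : ∀ j k, ∑ i, ∑ l, G⁻¹ i l * B i j k l = c * G j k) (i j k l : Fin 3) :
    B i j k l = c / 2 * (G j k * G i l - G i k * G j l) := by
  have hu : IsUnit G.det := isUnit_iff_ne_zero.mpr hG
  have hGs : G.IsSymm := Matrix.IsSymm.ext fun i j => hs j i
  have e1 : ∀ j l, ∑ i, G⁻¹ l i * G i j = if l = j then 1 else 0 := by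
    intro j l
    have := congrFun (congrFun (Matrix.nonsing_inv_mul G hu) l) j
    rwa [Matrix.mul_apply, Matrix.one_apply] at this
  have hs' : ∀ i j, G⁻¹ i j = G⁻¹ j i := fun i j => by
    rw [← Matrix.transpose_apply G⁻¹ j i, Matrix.transpose_nonsing_inv, hGs.eq]
  -- Apply injectivity of the trace to the difference from the constant-curvature tensor. The trace
  -- of the latter is c/2 · (3 - 1) G = c G, whence the factor c/2.
  refine sub_eq_zero.mp (eq_zero_of_trace_eq_zero (H := G⁻¹)
    (D := fun i j k l => B i j k l - c / 2 * (G j k * G i l - G i k * G j l)) ?_ hs' ?_ ?_ ?_ _ _ _ _)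
  · exact (Matrix.isUnit_nonsing_inv_det G hu).ne_zero
  · intro i j k l; rw [h₁]; ring
  · intro i j k l; rw [h₂]; ring
  · intro j k
    simp only [mul_sub, Finset.sum_sub_distrib, h]
    have e2 : ∑ i, ∑ l, G⁻¹ i l * (c / 2 * (G j k * G i l)) = c / 2 * G j k * 3 := by
      have : ∀ i, ∑ l, G⁻¹ i l * (c / 2 * (G j k * G i l)) = c / 2 * G j k * 1 := by
        intro i
        have := e1 i i
        rw [if_pos rfl] at this
        rw [← this, Finset.mul_sum]
        exact Finset.sum_congr rfl fun l _ => by rw [hs i l]; ring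
      simp [this]; ring
    have e3 : ∑ i, ∑ l, G⁻¹ i l * (c / 2 * (G i k * G j l)) = c / 2 * G j k := by
      have : ∀ i, ∑ l, G⁻¹ i l * (c / 2 * (G i k * G j l))
          = c / 2 * G i k * if i = j then 1 else 0 := by
        intro i
        rw [← e1 j i, Finset.mul_sum]
        exact Finset.sum_congr rfl fun l _ => by rw [hs j l]; ring
      simp [this]
    rw [e2, e3]; ring

section

variable {F : Type*} {g : F → Matrix (Fin 3) (Fin 3) ℝ} {y : F}

theorem pair_comm (hs : ∀ i j, g y i j = g y j i) (u v : Fin 3 → ℝ) :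
    pair g y u v = pair g y v u := by
  unfold pair
  rw [Finset.sum_comm]
  refine Finset.sum_congr rfl fun i _ => Finset.sum_congr rfl fun j _ => ?_
  rw [hs j i]; ring

/-- Strict Cauchy–Schwarz: w = g(u,u) v - g(u,v) u is nonzero, and g(w,w) is g(u,u) times the Gram
determinant. -/
theorem pair_mul_pair_sub_ne_zero (hs : ∀ i j, g y i j = g y j i)
    (hpos : ∀ v, v ≠ 0 → 0 < pair g y v v) {u v : Fin 3 → ℝ} (huv : LinearIndependent ℝ ![u, v]) :
    pair g y u u * pair g y v v - pair g y u v ^ 2 ≠ 0 := by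
  have hu : 0 < pair g y u u := hpos u (huv.ne_zero 0)
  have hw : pair g y u u • v - pair g y u v • u ≠ 0 := by
    intro h0
    have := LinearIndependent.pair_iff.mp huv (-pair g y u v) (pair g y u u)
      (by rw [← h0, neg_smul]; abel)
    exact hu.ne' this.2
  have hww := hpos _ hw
  have e : ∀ α β : ℝ, pair g y (α • v - β • u) (α • v - β • u)
      = α ^ 2 * pair g y v v - α * β * pair g y v u - α * β * pair g y u v
        + β ^ 2 * pair g y u u := by
    intro α β
    simp only [pair, Finset.mul_sum, ← Finset.sum_sub_distrib, ← Finset.sum_add_distrib]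
    refine Finset.sum_congr rfl fun i _ => Finset.sum_congr rfl fun j _ => ?_
    simp only [Pi.sub_apply, Pi.smul_apply, smul_eq_mul]
    ring
  rw [e, pair_comm hs v u] at hww
  intro h0
  have : pair g y u u * (pair g y u u * pair g y v v - pair g y u v ^ 2) = 0 := by rw [h0, mul_zero]
  linarith

variable [NormedAddCommGroup F] [NormedSpace ℝ F] {U : Set F} (b : Module.Basis (Fin 3) ℝ F)

/-- An Einstein metric in dimension three has constant sectional curvature. -/
theorem sectional_eq_of_ricci_eq (hg : IsMetricOn g U) (hy : y ∈ U)
    (hpos : ∀ v, v ≠ 0 → 0 < pair g y v v) {c : ℝ} (hc : ∀ j k, ricci b g j k y = c * g y j k)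
    {u v : Fin 3 → ℝ} (huv : LinearIndependent ℝ ![u, v]) : sectional b g y u v = c / 2 := by
  have hs := hg.symm y hy
  have hu : IsUnit (g y).det := isUnit_iff_ne_zero.mpr (hg.det_ne_zero y hy)
  -- The lowered curvature tensor is antisymmetric in each pair of indices, and its trace is the
  -- Ricci tensor, so the Einstein condition determines it.
  have hB := eq_of_trace_eq (hg.det_ne_zero y hy) hs (c := c)
    (B := fun i j k l => ∑ s, riemann b g s i j k y * g y s l)
    (by
      intro i j k l
      simp only [← Finset.sum_neg_distrib]
      refine Finset.sum_congr rfl fun s _ => ?_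
      simp only [riemann, Finset.sum_sub_distrib]
      ring)
    (fun i j k l => hg.sum_riemann_lower_antisymm b hy i j k l)
    (by
      intro j k
      rw [← hc]
      refine Finset.sum_congr rfl fun i _ => ?_
      simp only [Finset.mul_sum]
      rw [Finset.sum_comm]
      have e1 : ∀ s, ∑ l, (g y)⁻¹ i l * g y l s = if i = s then 1 else 0 := by
        intro s
        have := congrFun (congrFun (Matrix.nonsing_inv_mul (g y) hu) i) s
        rwa [Matrix.mul_apply, Matrix.one_apply] at this
      have e2 : ∀ s, ∑ l, (g y)⁻¹ i l * (riemann b g s i j k y * g y s l)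
          = riemann b g s i j k y * if i = s then 1 else 0 := by
        intro s
        rw [← e1 s, Finset.mul_sum]
        exact Finset.sum_congr rfl fun l _ => by rw [hs s l]; ring
      simp [e2])
  rw [sectional, div_eq_iff (pair_mul_pair_sub_ne_zero hs hpos huv)]
  have e3 : pair g y (fun l => ∑ i, ∑ j, ∑ k, riemann b g l i j k y * u i * v j * v k) u
      = ∑ i, ∑ j, ∑ k, ∑ l, (c / 2 * (g y j k * g y i l - g y i k * g y j l))
        * (u i * v j * v k * u l) := by
    simp only [← hB, pair, Finset.sum_mul, Finset.mul_sum]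
    rw [Finset.sum_comm_cycle]
    refine Finset.sum_congr rfl fun i _ => ?_
    rw [Finset.sum_comm_cycle]
    refine Finset.sum_congr rfl fun j _ => ?_
    rw [Finset.sum_comm_cycle]
    refine Finset.sum_congr rfl fun k _ => ?_
    rw [Finset.sum_comm]
    exact Finset.sum_congr rfl fun t _ => Finset.sum_congr rfl fun s _ => by ring
  -- The Gram determinant is the same contraction without the factor c/2.
  have e4 : pair g y u u * pair g y v v - pair g y u v ^ 2
      = ∑ i, ∑ j, ∑ k, ∑ l, (g y j k * g y i l - g y i k * g y j l)
        * (u i * v j * v k * u l) := by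
    simp only [pair, Fin.sum_univ_three, hs 1 0, hs 2 0, hs 2 1]
    ring
  rw [e3, e4]
  simp only [Finset.mul_sum, mul_assoc]

end

/-! ### Warped products with a timelike interval -/

section

variable {κ F : Type*}

/-- The matrix of the warped product metric `-dt² + a(t)² G`. -/
noncomputable def warped (a : ℝ → ℝ) (G : F → Matrix κ κ ℝ) (x : ℝ × F) :
    Matrix (Unit ⊕ κ) (Unit ⊕ κ) ℝ :=
  Matrix.fromBlocks (-1) 0 0 (a x.1 ^ 2 • G x.2)

theorem warped_inv [Fintype κ] [DecidableEq κ] {a : ℝ → ℝ} {G : F → Matrix κ κ ℝ} {x : ℝ × F}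
    (ha : a x.1 ≠ 0) (hG : (G x.2).det ≠ 0) :
    (warped a G x)⁻¹ = Matrix.fromBlocks (-1) 0 0 ((a x.1 ^ 2)⁻¹ • (G x.2)⁻¹) := by
  refine Matrix.inv_eq_right_inv ?_
  rw [warped, Matrix.fromBlocks_multiply]
  have : G x.2 * (G x.2)⁻¹ = 1 := Matrix.mul_nonsing_inv _ (isUnit_iff_ne_zero.mpr hG)
  simp [this, ha, smul_smul]

variable [NormedAddCommGroup F] [NormedSpace ℝ F]

/-- The basis of `ℝ × F` given by a basis of `F`. -/
noncomputable abbrev prodBasis (b : Module.Basis κ ℝ F) : Module.Basis (Unit ⊕ κ) ℝ (ℝ × F) :=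
  (Module.Basis.singleton Unit ℝ).prod b

variable (b : Module.Basis κ ℝ F) {a : ℝ → ℝ} {G : F → Matrix κ κ ℝ} {J : Set ℝ} {U : Set F}
  {x : ℝ × F}

/-- The nonconstant components and symbols differentiated for a warped product have the form α(t)
h(y), so this rule and its fibre counterpart suffice. -/
theorem pd_inl_prod {α : ℝ → ℝ} {h : F → ℝ} (hα : DifferentiableAt ℝ α x.1)
    (hh : DifferentiableAt ℝ h x.2) :
    pd (prodBasis b) (Sum.inl ()) (fun z => α z.1 * h z.2) x = deriv α x.1 * h x.2 := by
  have h1 : HasFDerivAt (fun z : ℝ × F => α z.1) _ x := hα.hasFDerivAt.comp x hasFDerivAt_fst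
  have h2 : HasFDerivAt (fun z : ℝ × F => h z.2) _ x := hh.hasFDerivAt.comp x hasFDerivAt_snd
  rw [pd, (h1.fun_mul h2).fderiv]
  simp [mul_comm]

theorem pd_inr_prod {α : ℝ → ℝ} {h : F → ℝ} (hα : DifferentiableAt ℝ α x.1)
    (hh : DifferentiableAt ℝ h x.2) (i : κ) :
    pd (prodBasis b) (Sum.inr i) (fun z => α z.1 * h z.2) x = α x.1 * pd b i h x.2 := by
  have h1 : HasFDerivAt (fun z : ℝ × F => α z.1) _ x := hα.hasFDerivAt.comp x hasFDerivAt_fst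
  have h2 : HasFDerivAt (fun z : ℝ × F => h z.2) _ x := hh.hasFDerivAt.comp x hasFDerivAt_snd
  rw [pd, (h1.fun_mul h2).fderiv]
  simp [pd]

theorem pd_warped_inl (i j k) :
    pd (prodBasis b) k (fun y => warped a G y (Sum.inl i) j) x = 0 := by
  rcases j with j | j <;> exact pd_const _ _ _

theorem pd_warped_inr_inl (i j k) :
    pd (prodBasis b) k (fun y => warped a G y (Sum.inr i) (Sum.inl j)) x = 0 :=
  pd_const _ _ _

variable [Fintype κ] [DecidableEq κ]

theorem IsMetricOn.warped (hJ : IsOpen J) (ha : ContDiffOn ℝ ∞ a J) (ha0 : ∀ t ∈ J, a t ≠ 0)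
    (hG : IsMetricOn G U) : IsMetricOn (warped a G) (J ×ˢ U) where
  isOpen := hJ.prod hG.isOpen
  smooth := by
    rintro (i | i) (j | j)
    · exact contDiffOn_const
    · exact contDiffOn_const
    · exact contDiffOn_const
    · exact ((ha.comp contDiffOn_fst fun z hz => hz.1).pow 2).mul
        ((hG.smooth i j).comp contDiffOn_snd fun z hz => hz.2)
  symm := by
    rintro y hy (i | i) (j | j)
    · rfl
    · rfl
    · rfl
    · simp [Coord.warped, hG.symm y.2 hy.2 i j]
  det_ne_zero := by
    intro y hy
    rw [Coord.warped, Matrix.det_fromBlocks_zero₂₁]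
    simp [ha0 y.1 hy.1, hG.det_ne_zero y.2 hy.2]

theorem christoffel_warped_inl_inl (ha0 : ∀ t ∈ J, a t ≠ 0) (hG : IsMetricOn G U)
    (hx : x ∈ J ×ˢ U) (j) :
    christoffel (prodBasis b) (warped a G) (Sum.inl ()) (Sum.inl ()) j x = 0 := by
  rcases j with j | j <;>
  simp [christoffel, Fintype.sum_sum_type, warped_inv (ha0 _ hx.1) (hG.det_ne_zero _ hx.2),
    pd_warped_inl, pd_warped_inr_inl]

section

variable (hJ : IsOpen J) (ha : ContDiffOn ℝ ∞ a J) (ha0 : ∀ t ∈ J, a t ≠ 0)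
  (hG : IsMetricOn G U) (hx : x ∈ J ×ˢ U)
include hJ ha hG hx

theorem pd_inl_warped_inr_inr (i j : κ) :
    pd (prodBasis b) (Sum.inl ()) (fun y => warped a G y (Sum.inr i) (Sum.inr j)) x
      = 2 * a x.1 * deriv a x.1 * G x.2 i j := by
  have da := ha.differentiableAt_of_isOpen hJ hx.1
  have := pd_inl_prod b (x := x) (da.pow 2)
    ((hG.smooth i j).differentiableAt_of_isOpen hG.isOpen hx.2)
  rw [show deriv (a ^ 2) x.1 = 2 * a x.1 * deriv a x.1 by rw [deriv_pow da]; simp] at this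
  exact this

theorem pd_inr_warped_inr_inr (i j k : κ) :
    pd (prodBasis b) (Sum.inr k) (fun y => warped a G y (Sum.inr i) (Sum.inr j)) x
      = a x.1 ^ 2 * pd b k (fun y => G y i j) x.2 :=
  pd_inr_prod b (x := x) ((ha.differentiableAt_of_isOpen hJ hx.1).pow 2)
    ((hG.smooth i j).differentiableAt_of_isOpen hG.isOpen hx.2) k

include ha0

/-- Only -½ gᵗᵗ ∂ₜ(a² Gᵢⱼ) contributes, and gᵗᵗ = -1 makes the sign positive. -/
theorem christoffel_warped_inl_inr_inr (i j : κ) :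
    christoffel (prodBasis b) (warped a G) (Sum.inl ()) (Sum.inr i) (Sum.inr j) x
      = (a x.1 * deriv a x.1) * G x.2 i j := by
  simp [christoffel, Fintype.sum_sum_type, warped_inv (ha0 _ hx.1) (hG.det_ne_zero _ hx.2),
    pd_warped_inr_inl, pd_inl_warped_inr_inr b hJ ha hG hx]
  ring

theorem christoffel_warped_inr_inl_inr (k j : κ) :
    christoffel (prodBasis b) (warped a G) (Sum.inr k) (Sum.inl ()) (Sum.inr j) x
      = (deriv a x.1 / a x.1) * if k = j then 1 else 0 := by
  have h1 : ∑ l, (G x.2)⁻¹ k l * G x.2 l j = if k = j then 1 else 0 := by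
    have := congrFun (congrFun (Matrix.nonsing_inv_mul (G x.2)
      (isUnit_iff_ne_zero.mpr (hG.det_ne_zero _ hx.2))) k) j
    rwa [Matrix.mul_apply, Matrix.one_apply] at this
  rw [← h1]
  have := ha0 _ hx.1
  simp only [christoffel, Fintype.sum_sum_type, warped_inv (ha0 _ hx.1) (hG.det_ne_zero _ hx.2),
    pd_warped_inl, pd_inl_warped_inr_inr b hJ ha hG hx, Matrix.fromBlocks_apply₂₁,
    Matrix.fromBlocks_apply₂₂, Matrix.smul_apply, Matrix.zero_apply, smul_eq_mul,
    Finset.mul_sum, zero_mul, Finset.sum_const_zero, zero_add]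
  refine Finset.sum_congr rfl fun l _ => ?_
  rw [hG.symm _ hx.2 l j]
  field_simp
  ring

theorem christoffel_warped_inr_inr_inr (k i j : κ) :
    christoffel (prodBasis b) (warped a G) (Sum.inr k) (Sum.inr i) (Sum.inr j) x
      = christoffel b G k i j x.2 := by
  have := ha0 _ hx.1
  simp only [christoffel, Fintype.sum_sum_type, warped_inv (ha0 _ hx.1) (hG.det_ne_zero _ hx.2),
    pd_inr_warped_inr_inr b hJ ha hG hx, Matrix.fromBlocks_apply₂₁,
    Matrix.fromBlocks_apply₂₂, Matrix.smul_apply, Matrix.zero_apply, smul_eq_mul, zero_mul,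
    Finset.sum_const_zero, zero_add]
  congr 1
  refine Finset.sum_congr rfl fun l _ => ?_
  field_simp

/-- The Ricci tensor of a warped product, on vectors tangent to the fibre. -/
theorem ricci_warped_inr_inr (j k : κ) :
    ricci (prodBasis b) (warped a G) (Sum.inr j) (Sum.inr k) x
      = ricci b G j k x.2 + (a x.1 * deriv (deriv a) x.1
        + (Fintype.card κ - 1) * deriv a x.1 ^ 2) * G x.2 j k := by
  have hW := hG.warped hJ ha ha0
  have a0 := ha0 _ hx.1
  have da := ha.differentiableAt_of_isOpen hJ hx.1
  have dda : DifferentiableAt ℝ (deriv a) x.1 :=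
    (ha.deriv_of_isOpen hJ (m := ∞) le_rfl).differentiableAt_of_isOpen hJ hx.1
  -- The symbols are needed on the whole open set, since the curvature involves their derivatives.
  have c1 : ∀ z ∈ J ×ˢ U, ∀ i j, _ := fun z hz =>
    christoffel_warped_inl_inr_inr b hJ ha ha0 hG hz
  have c2 : ∀ z ∈ J ×ˢ U, ∀ i j, _ := fun z hz =>
    christoffel_warped_inr_inl_inr b hJ ha ha0 hG hz
  have c3 : ∀ z ∈ J ×ˢ U, ∀ k i j, _ := fun z hz =>
    christoffel_warped_inr_inr_inr b hJ ha ha0 hG hz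
  have c4 : ∀ z ∈ J ×ˢ U, ∀ j, _ := fun z hz => christoffel_warped_inl_inl b ha0 hG hz
  have c5 : ∀ k i, christoffel (prodBasis b) (warped a G) (Sum.inr k) (Sum.inr i) (Sum.inl ()) x
      = (deriv a x.1 / a x.1) * if k = i then 1 else 0 := fun k i => by
    rw [hW.christoffel_symm _ hx, c2 x hx]
  have p1 : pd (prodBasis b) (Sum.inl ())
      (christoffel (prodBasis b) (warped a G) (Sum.inl ()) (Sum.inr j) (Sum.inr k)) x
      = (deriv a x.1 ^ 2 + a x.1 * deriv (deriv a) x.1) * G x.2 j k := by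
    rw [pd_congr _ hW.isOpen hx _ fun z hz => c1 z hz j k,
      pd_inl_prod b (x := x) (α := fun t => a t * deriv a t) (h := fun y => G y j k)
        (da.fun_mul dda) ((hG.smooth j k).differentiableAt_of_isOpen hG.isOpen hx.2),
      deriv_fun_mul da dda]
    ring
  have p2 : pd (prodBasis b) (Sum.inr j)
      (christoffel (prodBasis b) (warped a G) (Sum.inl ()) (Sum.inl ()) (Sum.inr k)) x = 0 := by
    rw [pd_congr _ hW.isOpen hx _ fun z hz => c4 z hz _, pd_const]
  have p3 : ∀ l i j k, pd (prodBasis b) (Sum.inr l)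
      (christoffel (prodBasis b) (warped a G) (Sum.inr k) (Sum.inr i) (Sum.inr j)) x
      = pd b l (christoffel b G k i j) x.2 := by
    intro l i j k
    rw [pd_congr _ hW.isOpen hx _ fun z hz =>
      (c3 z hz k i j).trans (one_mul (christoffel b G k i j z.2)).symm,
      pd_inr_prod b (x := x) (α := fun _ => 1) (h := christoffel b G k i j)
        (differentiableAt_const _)
        ((hG.contDiffOn_christoffel b k i j).differentiableAt_of_isOpen hG.isOpen hx.2), one_mul]
  -- The time part of the trace: the a'² from ∂ₜ(a a') is cancelled by the product a a' · a'/a.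
  have r1 : riemann (prodBasis b) (warped a G) (Sum.inl ()) (Sum.inl ()) (Sum.inr j) (Sum.inr k) x
      = a x.1 * deriv (deriv a) x.1 * G x.2 j k := by
    simp only [riemann, p1, p2, Fintype.sum_sum_type, c4 x hx, c2 x hx, c1 x hx,
      hW.christoffel_symm _ hx (Sum.inl ()) (Sum.inr _) (Sum.inl ()), Finset.univ_unique,
      Finset.sum_singleton]
    simp
    field_simp
    ring
  -- Summing the correction over i produces the factor (dim - 1) of a'².
  have r2 : ∀ i, riemann (prodBasis b) (warped a G) (Sum.inr i) (Sum.inr i) (Sum.inr j)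
      (Sum.inr k) x = riemann b G i i j k x.2
        + deriv a x.1 ^ 2 * (G x.2 j k - G x.2 i k * if i = j then 1 else 0) := by
    intro i
    simp only [riemann, p3, Fintype.sum_sum_type, c5, c3 x hx, c1 x hx, Finset.univ_unique,
      Finset.sum_singleton]
    by_cases h : i = j
    · subst h
      simp
    · simp [h]
      field_simp
      ring
  simp only [ricci, Fintype.sum_sum_type, Finset.univ_unique, Finset.sum_singleton]
  simp only [r2, Finset.sum_add_distrib, ← Finset.mul_sum, Finset.sum_sub_distrib]
  rw [show (default : Unit) = () from rfl, r1]
  simp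
  ring

end

end

end Coord

/-! ### Functions, vector fields and differentials in a chart -/

namespace InChart

variable {E : Type*} [NormedAddCommGroup E] [NormedSpace ℝ E]
  {H : Type*} [TopologicalSpace H] (I : ModelWithCorners ℝ E H)
  {M : Type*} [TopologicalSpace M] {e : OpenPartialHomeomorph M H} {x : E}

theorem symm_mem_source (hx : x ∈ (e.extend I).target) : (e.extend I).symm x ∈ e.source := by
  rw [← e.extend_source (I := I)]
  exact (e.extend I).map_target hx

variable [ChartedSpace H M] [IsManifold I ∞ M] (he : e ∈ atlas H M)

include he

theorem contMDiffOn_extend : ContMDiffOn I 𝓘(ℝ, E) ∞ (e.extend I) e.source :=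
  e.contMDiffOn_extend (IsManifold.subset_maximalAtlas he)

theorem contMDiffOn_symm :
    ContMDiffOn 𝓘(ℝ, E) I ∞ (e.extend I).symm (e.extend I).target := by
  have := contMDiffOn_extend_symm (I := I) (n := ∞) (IsManifold.subset_maximalAtlas he)
  rwa [I.image_eq, ← e.extend_target] at this

theorem mdifferentiableAt_extend {p : M} (hp : p ∈ e.source) :
    MDifferentiableAt I 𝓘(ℝ, E) (e.extend I) p :=
  ((contMDiffOn_extend I he).contMDiffAt (e.open_source.mem_nhds hp)).mdifferentiableAt (by simp)

theorem contDiffOn_func {f : M → ℝ} {C : Set M} (hf : ContMDiffOn I 𝓘(ℝ, ℝ) ∞ f C) :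
    ContDiffOn ℝ ∞ (func I e f) ((e.extend I).target ∩ (e.extend I).symm ⁻¹' C) := by
  rw [← contMDiffOn_iff_contDiffOn]
  exact hf.comp ((contMDiffOn_symm I he).mono Set.inter_subset_left) fun y hy => hy.2

/-- The components come from applying the tangent map of the chart to ρ and projecting to the fibre
of the trivial tangent bundle of E; each step is smooth. -/
theorem contDiffOn_vec {ι : Type*} [Fintype ι] (b : Module.Basis ι ℝ E)
    {ρ : ∀ p : M, TangentSpace I p} {C : Set M}
    (hρ : ContMDiffOn I I.tangent ∞ (fun p => (⟨p, ρ p⟩ : TangentBundle I M)) C) (k : ι) :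
    ContDiffOn ℝ ∞ (vec I b e ρ k) ((e.extend I).target ∩ (e.extend I).symm ⁻¹' C) := by
  have : FiniteDimensional ℝ E := b.finiteDimensional_of_finite
  have h1 := hρ.comp ((contMDiffOn_symm I he).mono
    (Set.inter_subset_left (t := (e.extend I).symm ⁻¹' C))) fun y hy => hy.2
  have h2 := (contMDiffOn_extend I he).contMDiffOn_tangentMapWithin (m := ∞) le_rfl
    e.open_source.uniqueMDiffOn
  have h3 := (contMDiff_snd_tangentBundle_modelSpace E 𝓘(ℝ, E) (n := ∞)).comp_contMDiffOn
    (h2.comp h1 fun y hy => symm_mem_source I hy.1)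
  rw [contMDiffOn_iff_contDiffOn] at h3
  refine ((b.coord k).toContinuousLinearMap.contDiff.comp_contDiffOn h3).congr fun y hy => ?_
  simp only [tangentMapWithin, Function.comp,
    mfderivWithin_of_isOpen e.open_source (symm_mem_source I hy.1)]
  rfl

variable [I.Boundaryless] {ι : Type*} (b : Module.Basis ι ℝ E)

theorem mdifferentiableAt_symm (hx : x ∈ (e.extend I).target) :
    MDifferentiableAt 𝓘(ℝ, E) I (e.extend I).symm x :=
  ((contMDiffOn_symm I he).contMDiffAt (e.isOpen_extend_target.mem_nhds hx)).mdifferentiableAt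
    (by simp)

theorem mfderiv_extend_symm (hx : x ∈ (e.extend I).target) (v : E) :
    mfderiv I 𝓘(ℝ, E) (e.extend I) ((e.extend I).symm x)
      (mfderiv 𝓘(ℝ, E) I (e.extend I).symm x v) = v := by
  have h1 := mfderiv_comp x (mdifferentiableAt_extend I he (symm_mem_source I hx))
    (mdifferentiableAt_symm I he hx)
  have h2 : mfderiv 𝓘(ℝ, E) 𝓘(ℝ, E) ((e.extend I) ∘ (e.extend I).symm) x
      = mfderiv 𝓘(ℝ, E) 𝓘(ℝ, E) id x := by
    refine Filter.EventuallyEq.mfderiv_eq ?_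
    filter_upwards [e.isOpen_extend_target.mem_nhds hx] with y hy
    exact (e.extend I).right_inv hy
  rw [h1, mfderiv_id] at h2
  exact DFunLike.congr_fun h2 v

/-- The derivative along a vector field, in coordinates. -/
theorem along_eq [Fintype ι] {f : M → ℝ} (hx : x ∈ (e.extend I).target)
    (hf : MDifferentiableAt I 𝓘(ℝ, ℝ) f ((e.extend I).symm x))
    (ρ : ∀ p : M, TangentSpace I p) :
    along I ρ f ((e.extend I).symm x) = ∑ k, vec I b e ρ k x * Coord.pd b k (func I e f) x := by
  have hs := symm_mem_source I hx
  have hd := mdifferentiableAt_symm I he hx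
  have hfd : MDifferentiableAt 𝓘(ℝ, E) 𝓘(ℝ, ℝ) (func I e f) x := hf.comp x hd
  have hr : e.extend I ((e.extend I).symm x) = x := (e.extend I).right_inv hx
  have hfd' : MDifferentiableAt 𝓘(ℝ, E) 𝓘(ℝ, ℝ) (func I e f)
      (e.extend I ((e.extend I).symm x)) := by rwa [hr]
  have h1 := mfderiv_comp ((e.extend I).symm x) hfd' (mdifferentiableAt_extend I he hs)
  have h2 : mfderiv I 𝓘(ℝ, ℝ) (func I e f ∘ e.extend I) ((e.extend I).symm x)
      = mfderiv I 𝓘(ℝ, ℝ) f ((e.extend I).symm x) := by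
    refine Filter.EventuallyEq.mfderiv_eq ?_
    filter_upwards [e.open_source.mem_nhds hs] with y hy
    exact congrArg f ((e.extend I).left_inv (by rwa [e.extend_source]))
  rw [along, ← h2, h1, hr, mfderiv_eq_fderiv]
  set w : E := mfderiv I 𝓘(ℝ, E) (e.extend I) ((e.extend I).symm x) (ρ ((e.extend I).symm x))
    with hw
  change fderiv ℝ (func I e f) x w = _
  conv_lhs => rw [← b.sum_repr w, map_sum]
  refine Finset.sum_congr rfl fun k _ => ?_
  rw [map_smul]
  rfl

/-- A coordinate field is the image of a constant field under the tangent map of the inverse chart.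
-/
theorem contMDiffOn_coordVec (i : ι) :
    ContMDiffOn 𝓘(ℝ, E) I.tangent ∞
      (fun x => (⟨(e.extend I).symm x, coordVec I b e i x⟩ : TangentBundle I M))
      (e.extend I).target := by
  have hO := e.isOpen_extend_target (I := I)
  have h1 : ContMDiffOn 𝓘(ℝ, E) 𝓘(ℝ, E).tangent ∞
      (fun x => (⟨x, b i⟩ : TangentBundle 𝓘(ℝ, E) E)) (e.extend I).target :=
    contMDiffOn_vectorSpace_iff_contDiffOn.2 contDiffOn_const
  have h2 := (contMDiffOn_symm I he).contMDiffOn_tangentMapWithin (m := ∞) le_rfl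
    hO.uniqueMDiffOn
  refine (h2.comp h1 fun x hx => hx).congr fun x hx => ?_
  simp only [tangentMapWithin, Function.comp, mfderivWithin_of_isOpen hO hx]
  rfl

end InChart

/-! ### Riemannian metrics in a chart -/

namespace InChart

variable {ι : Type*} [Fintype ι] {E : Type*} [NormedAddCommGroup E] [NormedSpace ℝ E]
  {H : Type*} [TopologicalSpace H] (I : ModelWithCorners ℝ E H) [I.Boundaryless]
  {M : Type*} [TopologicalSpace M] [ChartedSpace H M] [IsManifold I ∞ M]
  (b : Module.Basis ι ℝ E) {e : OpenPartialHomeomorph M H} (he : e ∈ atlas H M) {x : E}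
  (h : Bundle.ContMDiffRiemannianMetric I ∞ E (fun p : M => TangentSpace I p))

include he

/-- The form is h on the image of ∑ vᵢ bᵢ under the differential of the inverse chart, which is
injective since the differential of the chart is a left inverse. -/
theorem pair_metric_pos (hx : x ∈ (e.extend I).target) {v : ι → ℝ} (hv : v ≠ 0) :
    0 < Coord.pair (metric I b e fun p v w => h.inner p v w) x v v := by
  have h1 : Coord.pair (metric I b e fun p v w => h.inner p v w) x v v
      = h.inner ((e.extend I).symm x) (∑ i, v i • coordVec I b e i x)
        (∑ j, v j • coordVec I b e j x) := by
    simp only [map_sum, map_smul, sum_apply, smul_apply,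
      Coord.pair, metric, Matrix.of_apply, smul_eq_mul, Finset.mul_sum]
    refine Finset.sum_congr rfl fun i _ => Finset.sum_congr rfl fun j _ => ?_
    rw [h.symm]; ring
  let L : E →L[ℝ] E := mfderiv 𝓘(ℝ, E) I (e.extend I).symm x
  have h2 : ∑ i, v i • (L (b i)) = L (∑ i, v i • b i) := by
    rw [map_sum]
    exact Finset.sum_congr rfl fun i _ => (map_smul _ _ _).symm
  rw [h1]
  refine h.pos _ _ fun h0 => hv ?_
  have h3 : L (∑ i, v i • b i) = 0 := h2.symm.trans h0
  let L' : E →L[ℝ] E := mfderiv I 𝓘(ℝ, E) (e.extend I) ((e.extend I).symm x)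
  have h4 : L' (L (∑ i, v i • b i)) = ∑ i, v i • b i := mfderiv_extend_symm I he hx _
  rw [h3, map_zero] at h4
  exact funext fun i => Fintype.linearIndependent_iff.mp b.linearIndependent v h4.symm i

theorem isMetricOn_metric [DecidableEq ι] :
    Coord.IsMetricOn (metric I b e fun p v w => h.inner p v w) (e.extend I).target where
  isOpen := e.isOpen_extend_target
  smooth i j := by
    rw [← contMDiffOn_iff_contDiffOn]
    have h1 := h.contMDiff.comp_contMDiffOn (contMDiffOn_symm I he)
    have h2 := h1.clm_bundle_apply₂ (F₃ := ℝ) (E₃ := Bundle.Trivial M ℝ)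
      (contMDiffOn_coordVec I he b i) (contMDiffOn_coordVec I he b j)
    intro y hy
    exact (Bundle.contMDiffWithinAt_totalSpace.1 (h2 y hy)).2
  symm y hy i j := h.symm _ _ _
  det_ne_zero y hy h0 := by
    -- A kernel vector of the matrix would have length zero, against positivity.
    obtain ⟨v, hv, hv0⟩ := Matrix.exists_mulVec_eq_zero_iff.mpr h0
    refine (pair_metric_pos I b he h hy hv).ne' ?_
    have : Coord.pair (metric I b e fun p v w => h.inner p v w) y v v
        = ∑ i, (metric I b e (fun p v w => h.inner p v w) y).mulVec v i * v i := by
      simp only [Coord.pair, Matrix.mulVec, dotProduct, Finset.sum_mul]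
      exact Finset.sum_congr rfl fun i _ => Finset.sum_congr rfl fun j _ => by ring
    rw [this, hv0]
    simp

end InChart

/-! ### The spacetime metric in product charts -/

namespace GRWSpacetime

variable {d : ℕ} {N : Type*} [TopologicalSpace N]
  {e : OpenPartialHomeomorph N (EuclideanSpace ℝ (Fin d))}

/-- The chart of `ℝ × N` given by the identity of `ℝ` and a chart of `N`. -/
noncomputable def prodChart (e : OpenPartialHomeomorph N (EuclideanSpace ℝ (Fin d))) :
    OpenPartialHomeomorph (ℝ × N) (ModelProd ℝ (EuclideanSpace ℝ (Fin d))) :=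
  (OpenPartialHomeomorph.refl ℝ).prod e

theorem prodChart_extend_target :
    ((prodChart e).extend (spacetimeModel d)).target
      = Set.univ ×ˢ (e.extend (𝓡 d)).target := by
  rw [OpenPartialHomeomorph.extend_target, OpenPartialHomeomorph.extend_target]
  ext x
  change (x ∈ _ ∧ x ∈ _) ↔ _
  simp [prodChart]

variable [ChartedSpace (EuclideanSpace ℝ (Fin d)) N]

theorem prodChart_mem_atlas (he : e ∈ atlas (EuclideanSpace ℝ (Fin d)) N) :
    prodChart e ∈ atlas (ModelProd ℝ (EuclideanSpace ℝ (Fin d))) (ℝ × N) :=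
  Set.mem_image2_of_mem (by simp) he

variable [IsManifold (𝓡 d) ∞ N]

/-- The inverse of a product chart is the identity in t times the inverse chart of N. Its coordinate
fields are therefore (1, 0) and (0, ∂ᵢ), on which the mixed terms vanish. -/
theorem metric_prodChart (S : GRWSpacetime d N) (he : e ∈ atlas (EuclideanSpace ℝ (Fin d)) N)
    {x : ℝ × EuclideanSpace ℝ (Fin d)} (hx : x.2 ∈ (e.extend (𝓡 d)).target) :
    S.metric (prodChart e) x = Coord.warped S.scale
      (InChart.metric (𝓡 d) (stdBasis d) e fun p v w => S.fibreMetric.inner p v w) x := by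
  have h2 : HasMFDerivAt 𝓘(ℝ, ℝ × EuclideanSpace ℝ (Fin d)) (𝓡 d)
      (fun y : ℝ × EuclideanSpace ℝ (Fin d) => (e.extend (𝓡 d)).symm y.2) x _ :=
    (InChart.mdifferentiableAt_symm (𝓡 d) he hx).hasMFDerivAt.comp x
      hasFDerivAt_snd.hasMFDerivAt
  have h1 : HasMFDerivAt 𝓘(ℝ, ℝ × EuclideanSpace ℝ (Fin d)) 𝓘(ℝ, ℝ)
      (fun y : ℝ × EuclideanSpace ℝ (Fin d) => y.1) x _ := hasFDerivAt_fst.hasMFDerivAt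
  have h3 := (h1.prodMk h2).mfderiv
  let V : Unit ⊕ Fin d → ℝ × EuclideanSpace ℝ (Fin d) := fun i =>
    InChart.coordVec (spacetimeModel d) (spacetimeBasis d) (prodChart e) i x
  let V' : Fin d → EuclideanSpace ℝ (Fin d) := fun i =>
    InChart.coordVec (𝓡 d) (stdBasis d) e i x.2
  let B : EuclideanSpace ℝ (Fin d) →L[ℝ] EuclideanSpace ℝ (Fin d) →L[ℝ] ℝ :=
    S.fibreMetric.inner ((e.extend (𝓡 d)).symm x.2)
  let L : EuclideanSpace ℝ (Fin d) →L[ℝ] EuclideanSpace ℝ (Fin d) :=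
    mfderiv 𝓘(ℝ, EuclideanSpace ℝ (Fin d)) (𝓡 d) (e.extend (𝓡 d)).symm x.2
  have hV : ∀ i, V i = ((spacetimeBasis d i).1, L (spacetimeBasis d i).2) := fun i =>
    DFunLike.congr_fun h3 (spacetimeBasis d i)
  have c1 : ∀ i, V (Sum.inl i) = (1, 0) := fun i => by
    rw [hV]; simp
  have c2 : ∀ i, V (Sum.inr i) = (0, V' i) := fun i => by
    rw [hV]
    have : L (stdBasis d i) = V' i := rfl
    simp [← this]
  have key : ∀ i j, S.metric (prodChart e) x i j
      = -((V i).1 * (V j).1) + S.scale x.1 ^ 2 * B (V i).2 (V j).2 := fun _ _ => rfl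
  ext i j
  rw [key]
  rcases i with i | i <;> rcases j with j | j
  · simp only [c1]; simp [Coord.warped]
  · simp only [c1, c2]; simp [Coord.warped]
  · simp only [c1, c2]; simp [Coord.warped]
  · simp only [c2, mul_zero, neg_zero, zero_add]
    rfl

end GRWSpacetime

theorem Coord.IsMetricOn.congr {ι : Type*} [Fintype ι] [DecidableEq ι] {E : Type*}
    [NormedAddCommGroup E] [NormedSpace ℝ E] {g g' : E → Matrix ι ι ℝ} {O : Set E}
    (hg : Coord.IsMetricOn g O) (h : ∀ y ∈ O, g' y = g y) : Coord.IsMetricOn g' O where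
  isOpen := hg.isOpen
  smooth i j := (hg.smooth i j).congr fun y hy => by rw [h y hy]
  symm y hy i j := by rw [h y hy, hg.symm y hy]
  det_ne_zero y hy := by rw [h y hy]; exact hg.det_ne_zero y hy

/-- The differential of the chart is a left inverse of that of the inverse chart; in finite
dimension it is then also a right inverse. -/
theorem InChart.sum_vec_smul_coordVec {ι : Type*} [Fintype ι] {E : Type*} [NormedAddCommGroup E]
    [NormedSpace ℝ E] {H : Type*} [TopologicalSpace H] (I : ModelWithCorners ℝ E H)
    [I.Boundaryless] {M : Type*} [TopologicalSpace M] [ChartedSpace H M] [IsManifold I ∞ M]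
    (b : Module.Basis ι ℝ E) {e : OpenPartialHomeomorph M H} (he : e ∈ atlas H M) {x : E}
    (hx : x ∈ (e.extend I).target) (ρ : ∀ p : M, TangentSpace I p) :
    ∑ k, vec I b e ρ k x • coordVec I b e k x = ρ ((e.extend I).symm x) := by
  have : FiniteDimensional ℝ E := b.finiteDimensional_of_finite
  let L : E →L[ℝ] E := mfderiv 𝓘(ℝ, E) I (e.extend I).symm x
  let L' : E →L[ℝ] E := mfderiv I 𝓘(ℝ, E) (e.extend I) ((e.extend I).symm x)
  let r : E := ρ ((e.extend I).symm x)
  have h1 : (L' : E →ₗ[ℝ] E) * (L : E →ₗ[ℝ] E) = 1 :=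
    LinearMap.ext fun v => mfderiv_extend_symm I he hx v
  have h2 : L (L' r) = r := LinearMap.congr_fun (mul_eq_one_comm.mp h1) r
  have h3 : ∑ k, b.repr (L' r) k • L (b k) = L (L' r) := by
    conv_rhs => rw [← b.sum_repr (L' r), map_sum]
    exact Finset.sum_congr rfl fun k _ => (map_smul _ _ _).symm
  exact h3.trans h2

/-! ### From the spacetime hypotheses to their coordinate form -/

namespace GRWSpacetime

variable {d : ℕ} {N : Type*} [TopologicalSpace N] [ChartedSpace (EuclideanSpace ℝ (Fin d)) N]
  {e : OpenPartialHomeomorph N (EuclideanSpace ℝ (Fin d))} [IsManifold (𝓡 d) ∞ N]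
  (S : GRWSpacetime d N)

theorem isOpen_carrier : IsOpen S.carrier :=
  S.isOpen_interval.preimage continuous_fst

theorem target_inter_carrier :
    ((prodChart e).extend (spacetimeModel d)).target
      ∩ ((prodChart e).extend (spacetimeModel d)).symm ⁻¹' S.carrier
      = S.interval ×ˢ (e.extend (𝓡 d)).target := by
  rw [prodChart_extend_target]
  ext x
  exact ⟨fun h => ⟨h.2, h.1.2⟩, fun h => ⟨⟨Set.mem_univ _, h.2⟩, h.1⟩⟩

variable {S} in
-- Translates conditions at points of the manifold into conditions on an open set of coordinates,
-- where they can be differentiated.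
theorem Everywhere.apply
    {P : OpenPartialHomeomorph (ℝ × N) (ModelProd ℝ (EuclideanSpace ℝ (Fin d))) →
      ℝ × EuclideanSpace ℝ (Fin d) → Prop} (h : S.Everywhere P)
    (he : e ∈ atlas (EuclideanSpace ℝ (Fin d)) N) {x : ℝ × EuclideanSpace ℝ (Fin d)}
    (hx : x ∈ S.interval ×ˢ (e.extend (𝓡 d)).target) : P (prodChart e) x := by
  rw [← S.target_inter_carrier] at hx
  have := h _ (prodChart_mem_atlas he) _ (InChart.symm_mem_source _ hx.1) hx.2
  rwa [((prodChart e).extend (spacetimeModel d)).right_inv hx.1] at this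

theorem isMetricOn_fibre (he : e ∈ atlas (EuclideanSpace ℝ (Fin d)) N) :
    Coord.IsMetricOn (InChart.metric (𝓡 d) (stdBasis d) e fun p v w => S.fibreMetric.inner p v w)
      (e.extend (𝓡 d)).target :=
  InChart.isMetricOn_metric (𝓡 d) (stdBasis d) he S.fibreMetric

theorem isMetricOn_metric (he : e ∈ atlas (EuclideanSpace ℝ (Fin d)) N) :
    Coord.IsMetricOn (S.metric (prodChart e)) (S.interval ×ˢ (e.extend (𝓡 d)).target) :=
  ((S.isMetricOn_fibre he).warped S.isOpen_interval S.contDiffOn_scale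
    fun t ht => (S.scale_pos t ht).ne').congr fun _ hy => S.metric_prodChart he hy.2

theorem sum_metric_mul_vec (he : e ∈ atlas (EuclideanSpace ℝ (Fin d)) N)
    {x : ℝ × EuclideanSpace ℝ (Fin d)}
    (hx : x ∈ ((prodChart e).extend (spacetimeModel d)).target)
    (ρ : ∀ q : ℝ × N, TangentSpace (spacetimeModel d) q) :
    ∑ i, ∑ j, S.metric (prodChart e) x i j
        * InChart.vec (spacetimeModel d) (spacetimeBasis d) (prodChart e) ρ i x
        * InChart.vec (spacetimeModel d) (spacetimeBasis d) (prodChart e) ρ j x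
      = S.lorentz (((prodChart e).extend (spacetimeModel d)).symm x)
          (ρ (((prodChart e).extend (spacetimeModel d)).symm x))
          (ρ (((prodChart e).extend (spacetimeModel d)).symm x)) := by
  let V : Unit ⊕ Fin d → ℝ × EuclideanSpace ℝ (Fin d) := fun i =>
    InChart.coordVec (spacetimeModel d) (spacetimeBasis d) (prodChart e) i x
  let B : EuclideanSpace ℝ (Fin d) →L[ℝ] EuclideanSpace ℝ (Fin d) →L[ℝ] ℝ :=
    S.fibreMetric.inner ((e.extend (𝓡 d)).symm x.2)
  let r : ℝ × EuclideanSpace ℝ (Fin d) := ρ (((prodChart e).extend (spacetimeModel d)).symm x)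
  let c : Unit ⊕ Fin d → ℝ := fun k =>
    InChart.vec (spacetimeModel d) (spacetimeBasis d) (prodChart e) ρ k x
  have hr : ∑ k, c k • V k = r :=
    InChart.sum_vec_smul_coordVec (spacetimeModel d) (spacetimeBasis d) (prodChart_mem_atlas he)
      hx ρ
  have key : ∀ i j, S.metric (prodChart e) x i j
      = -((V i).1 * (V j).1) + S.scale x.1 ^ 2 * B (V i).2 (V j).2 := fun _ _ => rfl
  change ∑ i, ∑ j, S.metric (prodChart e) x i j * c i * c j
    = -(r.1 * r.1) + S.scale x.1 ^ 2 * B r.2 r.2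
  have h1 : r.1 * r.1 = ∑ i, ∑ j, (V i).1 * (V j).1 * c i * c j := by
    rw [← hr, Prod.fst_sum, Finset.sum_mul_sum]
    refine Finset.sum_congr rfl fun i _ => Finset.sum_congr rfl fun j _ => ?_
    simp only [Prod.smul_fst, smul_eq_mul]; ring
  have h2 : B r.2 r.2 = ∑ i, ∑ j, B (V i).2 (V j).2 * c i * c j := by
    rw [← hr, Prod.snd_sum]
    simp only [Prod.smul_snd, map_sum, map_smul, sum_apply, smul_apply, smul_eq_mul,
      Finset.mul_sum]
    rw [Finset.sum_comm]
    exact Finset.sum_congr rfl fun i _ => Finset.sum_congr rfl fun j _ => by ring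
  rw [h1, h2, ← Finset.sum_neg_distrib, Finset.mul_sum, ← Finset.sum_add_distrib]
  refine Finset.sum_congr rfl fun i _ => ?_
  rw [← Finset.sum_neg_distrib, Finset.mul_sum, ← Finset.sum_add_distrib]
  refine Finset.sum_congr rfl fun j _ => ?_
  rw [key]; ring

variable {S} {ρ : ∀ q : ℝ × N, TangentSpace (spacetimeModel d) q} {ψ : ℝ × N → ℝ}

theorem IsTorseForming.isTorseFormingOn (hρ : S.IsTorseForming ρ ψ)
    (he : e ∈ atlas (EuclideanSpace ℝ (Fin d)) N) :
    Coord.IsTorseFormingOn (spacetimeBasis d) (S.metric (prodChart e))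
      (InChart.vec (spacetimeModel d) (spacetimeBasis d) (prodChart e) ρ)
      (InChart.func (spacetimeModel d) (prodChart e) ψ)
      (S.interval ×ˢ (e.extend (𝓡 d)).target) where
  smooth i := by
    rw [← S.target_inter_carrier]
    exact InChart.contDiffOn_vec _ (prodChart_mem_atlas he) _ hρ.smooth i
  smooth_coeff := by
    rw [← S.target_inter_carrier]
    exact InChart.contDiffOn_func _ (prodChart_mem_atlas he) hρ.smooth_coeff
  unit y hy := by
    rw [← S.target_inter_carrier] at hy
    rw [S.sum_metric_mul_vec he hy.1]
    exact hρ.unit _ hy.2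
  torse y hy := hρ.torse.apply he hy

theorem along_eq_sum {f : ℝ × N → ℝ}
    (hf : ContMDiffOn (spacetimeModel d) 𝓘(ℝ, ℝ) ∞ f S.carrier)
    (he : e ∈ atlas (EuclideanSpace ℝ (Fin d)) N) {x : ℝ × EuclideanSpace ℝ (Fin d)}
    (hx : x ∈ S.interval ×ˢ (e.extend (𝓡 d)).target) :
    InChart.along (spacetimeModel d) ρ f (((prodChart e).extend (spacetimeModel d)).symm x)
      = ∑ k, InChart.vec (spacetimeModel d) (spacetimeBasis d) (prodChart e) ρ k x
        * Coord.pd (spacetimeBasis d) k (InChart.func (spacetimeModel d) (prodChart e) f) x := by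
  rw [← S.target_inter_carrier] at hx
  exact InChart.along_eq _ (prodChart_mem_atlas he) _ hx.1
    ((hf.contMDiffAt (S.isOpen_carrier.mem_nhds hx.2)).mdifferentiableAt (by simp)) ρ

/-- A gradient quasi Einstein soliton as in the main theorem is Einstein. -/
theorem ricci_eq_of_soliton (hρ : S.IsTorseForming ρ ψ) {m τ lam : ℝ} {f : ℝ × N → ℝ}
    (hf : S.IsGradientQES m τ lam f) {β : ℝ} (hβ : β ≠ 0)
    (hβ_eq : S.Everywhere fun e x =>
      lam + τ * Coord.scalar (spacetimeBasis d) (S.metric e) x = β)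
    (hμ : ∀ q ∈ S.carrier, β = d * mu ρ ψ q)
    {c : ℝ} (hc : ∀ q ∈ S.carrier, InChart.along (spacetimeModel d) ρ f q = c)
    (he : e ∈ atlas (EuclideanSpace ℝ (Fin d)) N) {x : ℝ × EuclideanSpace ℝ (Fin d)}
    (hx : x ∈ S.interval ×ˢ (e.extend (𝓡 d)).target) (i j : Unit ⊕ Fin d) :
    Coord.ricci (spacetimeBasis d) (S.metric (prodChart e)) i j x
      = β * S.metric (prodChart e) x i j := by
  have hmem : ∀ y ∈ S.interval ×ˢ (e.extend (𝓡 d)).target,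
      ((prodChart e).extend (spacetimeModel d)).symm y ∈ S.carrier := fun y hy => by
    rw [← S.target_inter_carrier] at hy
    exact hy.2
  obtain ⟨ξ, hξ⟩ := hρ.eigen
  refine (hρ.isTorseFormingOn he).ricci_eq_of_soliton (S.isMetricOn_metric he)
    (f := InChart.func (spacetimeModel d) (prodChart e) f) (m := m) (c := c)
    (fun y hy => ⟨_, hξ.apply he hy⟩) hf.pos.ne' hβ ?_ (fun y hy i j => ?_)
    (fun y hy => ?_) (fun y hy => ?_) hx i j
  · rw [← S.target_inter_carrier]
    exact InChart.contDiffOn_func _ (prodChart_mem_atlas he) hf.smooth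
  · rw [hf.eqn.apply he hy i j, hβ_eq.apply he hy]
  -- The index type has d + 1 elements, so n - 1 is the factor d of `hμ`.
  · rw [← along_eq_sum hρ.smooth_coeff he hy, hμ _ (hmem y hy), mu]
    simp [InChart.func]
  · rw [← along_eq_sum hf.smooth he hy, hc _ (hmem y hy)]

/-- The fibre of an Einstein generalized Robertson-Walker spacetime is Einstein. -/
theorem ricci_fibre_eq (he : e ∈ atlas (EuclideanSpace ℝ (Fin d)) N) {β t : ℝ}
    {y : EuclideanSpace ℝ (Fin d)} (ht : t ∈ S.interval) (hy : y ∈ (e.extend (𝓡 d)).target)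
    (h : ∀ i j, Coord.ricci (spacetimeBasis d) (S.metric (prodChart e)) i j (t, y)
      = β * S.metric (prodChart e) (t, y) i j) (j k : Fin d) :
    Coord.ricci (stdBasis d)
        (InChart.metric (𝓡 d) (stdBasis d) e fun p v w => S.fibreMetric.inner p v w) j k y
      = (β * S.scale t ^ 2 - (S.scale t * deriv (deriv S.scale) t
          + (d - 1) * deriv S.scale t ^ 2))
        * InChart.metric (𝓡 d) (stdBasis d) e (fun p v w => S.fibreMetric.inner p v w) y j k := by
  have hG := S.isMetricOn_fibre he
  have h1 := h (Sum.inr j) (Sum.inr k)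
  rw [Coord.ricci_congr (x := (t, y)) _ (S.isMetricOn_metric he).isOpen
      (fun _ hy => S.metric_prodChart he hy.2) ⟨ht, hy⟩,
    Coord.ricci_warped_inr_inr (x := (t, y)) (stdBasis d) S.isOpen_interval S.contDiffOn_scale
      (fun t ht => (S.scale_pos t ht).ne') hG ⟨ht, hy⟩,
    S.metric_prodChart (x := (t, y)) he hy] at h1
  simp only [Coord.warped, Matrix.fromBlocks_apply₂₂, Matrix.smul_apply, smul_eq_mul,
    Fintype.card_fin] at h1
  linear_combination h1

end GRWSpacetime

theorem mainTheorem4 {N : Type*} [TopologicalSpace N]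
    [ChartedSpace (EuclideanSpace ℝ (Fin 3)) N] [IsManifold (𝓡 3) ∞ N]
    (S : GRWSpacetime 3 N)
    (ρ : ∀ q : ℝ × N, TangentSpace (spacetimeModel 3) q) (ψ : ℝ × N → ℝ)
    (hρ : S.IsTorseForming ρ ψ)
    (m τ lam : ℝ) (f : ℝ × N → ℝ) (hf : S.IsGradientQES m τ lam f)
    (β₁ : ℝ) (hβ₁ : β₁ ≠ 0)
    (hβ₁_eq : S.Everywhere fun e x =>
      lam + τ * Coord.scalar (spacetimeBasis 3) (S.metric e) x = β₁)
    (hμ : ∀ q ∈ S.carrier, β₁ = 3 * GRWSpacetime.mu ρ ψ q)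
    (c₁ : ℝ) (hc₁ : ∀ q ∈ S.carrier, InChart.along (spacetimeModel 3) ρ f q = c₁) :
    S.IsRobertsonWalker := by
  -- One instant t serves for all points of the fibre. The Einstein constant of the fibre, read off
  -- at t, is thus the same everywhere, with no appeal to Schur's lemma or connectedness; half of it
  -- is the curvature.
  obtain ⟨t, ht⟩ := S.nonempty_interval
  refine ⟨(β₁ * S.scale t ^ 2 - (S.scale t * deriv (deriv S.scale) t
    + ((3 : ℕ) - 1) * deriv S.scale t ^ 2)) / 2, fun e he p hp u v huv => ?_⟩
  have hy : e.extend (𝓡 3) p ∈ (e.extend (𝓡 3)).target :=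
    (e.extend (𝓡 3)).map_source (by rwa [e.extend_source])
  exact Coord.sectional_eq_of_ricci_eq (stdBasis 3) (S.isMetricOn_fibre he) hy
    (fun v hv => InChart.pair_metric_pos (𝓡 3) (stdBasis 3) he S.fibreMetric hy hv)
    (GRWSpacetime.ricci_fibre_eq he ht hy fun i j =>
      GRWSpacetime.ricci_eq_of_soliton hρ hf hβ₁ hβ₁_eq hμ hc₁ he ⟨ht, hy⟩ i j) huv
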